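/- Let $X$ be a Cantor space (a nonempty, compact, totally disconnected metric space without isolated points), with its fixed compatible metric. For a set $K$ of Borel probability measures on $X$ and clopen sets $A,B\subseteq X$, write $A\sim_K B$ if $\mu(A)=\mu(B)$ for all $\mu\in K$. A nonempty set $K$ of Borel probability measures on $X$ is a \emph{dynamical simplex} if it is convex and compact for the weak-$*$ topology; every $\mu\in K$ is atomless and has full support; $K$ is good, i.e. whenever $A,B$ are clopen and $\mu(A)<\mu(B)$ for all $\mu\in K$, there is a clopen $C\subseteq B$ with $C\sim_K A$; and $K$ is approximately divisible, i.e. for every clopen $A$, every integer $n\ge 1$ and every $\varepsilon>0$ there is a clopen $B\subseteq A$ with $n\mu(B)\in[\mu(A)-\varepsilon,\mu(A)]$ for all $\mu\in K$. Let $K$ be a dynamical simplex and let $G$ be the group of all homeomorphisms $g$ of $X$ with $g_*\mu=\mu$ for all $\mu\in K$, with the topology of uniform convergence. For a homeomorphism $g$ of $X$, the topological full group $[[g]]$ is the group of all homeomorphisms $h$ of $X$ for which there are a finite clopen partition $A_1,\dots,A_m$ of $X$ and integers $n_1,\dots,n_m$ with $h(x)=g^{n_i}(x)$ for all $x\in A_i$.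 An element $g\in G$ is \emph{$K$-saturated} if for all clopen $U,V$ with $U\sim_K V$ there is $h\in[[g]]$ with $h(U)=V$. A \emph{KR-partition} is a finite partition of $X$ into nonempty clopen atoms $B_{i,r}$ ($0\le i\le k$, $0\le r\le j_i$), arranged in columns $(B_{i,0},\dots,B_{i,j_i})$, such that $B_{i,r}\sim_K B_{i,s}$ for all $i$ and all $r,s\le j_i$; its base is $\bigcup_i B_{i,0}$ and its top is $\bigcup_i B_{i,j_i}$. A homeomorphism $h$ of $X$ \emph{extends} it if $h(B_{i,r})=B_{i,r+1}$ for all $i$ and all $r<j_i$, and $h$ maps the top onto the base. A KR-partition $\mathcal S$ \emph{refines} a KR-partition $\mathcal T$ if the base (respectively, top) of $\mathcal S$ is contained in the base (respectively, top) of $\mathcal T$, and every column of $\mathcal S$ is the concatenation of finitely many (at least one) blocks $(S_0,\dots,S_j)$, each with $S_r\subseteq B_r$ ($0\le r\le j$) for some column $(B_0,\dots,B_j)$ of $\mathcal T$. Then: 1. $G$ contains a $K$-saturated element $g$ which, moreover, is the limit of a refining sequence of KR-partitions whose bases and tops shrink: there are KR-partitions $(\mathcal S_n)_{n\in\mathbb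 N}$ such that $\mathcal S_{n+1}$ refines $\mathcal S_n$ for all $n$, the diameters of the base and of the top of $\mathcal S_n$ tend to $0$, and $g$ is the unique homeomorphism of $X$ that extends all the $\mathcal S_n$. 2. If $g\in G$ is $K$-saturated, then $g$ is minimal (every orbit $\{g^n(x):n\in\mathbb Z\}$ is dense in $X$), and $[[g]]$ is contained in $G$ and dense in $G$. -/

import Mathlib

open MeasureTheory Set Filter Topology
open scoped NNReal

namespace DynSimplex

/-- `A ∼_K B`: every measure of `K` gives the sets `A` and `B` the same mass. -/
def KEquiv {X : Type*} [MeasurableSpace X] (K : Set (ProbabilityMeasure X)) (A B : Set X) : Prop :=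
  ∀ μ ∈ K, μ A = μ B

/-- `K` is good: if `μ A < μ B` for all `μ ∈ K`, with `A`, `B` clopen, then `B` has a clopen
subset that is `K`-equivalent to `A`. -/
def IsGood {X : Type*} [TopologicalSpace X] [MeasurableSpace X]
    (K : Set (ProbabilityMeasure X)) : Prop :=
  ∀ A B : Set X, IsClopen A → IsClopen B → (∀ μ ∈ K, μ A < μ B) →
    ∃ C : Set X, IsClopen C ∧ C ⊆ B ∧ ∀ μ ∈ K, μ C = μ A

/-- Approximate divisibility: for every clopen `A`, every positive integer `n` and every `ε > 0`
there is a clopen `B ⊆ A` with `n μ(B) ∈ [μ(A) - ε, μ(A)]` for all `μ ∈ K`. -/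
def IsApproxDivisible {X : Type*} [TopologicalSpace X] [MeasurableSpace X]
    (K : Set (ProbabilityMeasure X)) : Prop :=
  ∀ A : Set X, IsClopen A → ∀ n : ℕ, 0 < n → ∀ ε : ℝ, 0 < ε →
    ∃ B : Set X, IsClopen B ∧ B ⊆ A ∧
      ∀ μ ∈ K, (n : ℝ) * (μ B : ℝ) ∈ Set.Icc ((μ A : ℝ) - ε) (μ A : ℝ)

/-- Dynamical simplices: nonempty, compact (for the weak-* topology), convex, good and
approximately divisible sets of atomless probability measures with full support. Convexity is
that of `K` seen inside the cone of finite measures. -/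
structure IsDynamicalSimplex {X : Type*} [TopologicalSpace X] [MeasurableSpace X]
    [OpensMeasurableSpace X] (K : Set (ProbabilityMeasure X)) : Prop where
  nonempty : K.Nonempty
  isCompact : IsCompact K
  convex : Convex ℝ≥0 (ProbabilityMeasure.toFiniteMeasure '' K)
  atomless : ∀ μ ∈ K, NullSingletonClass (μ : Measure X)
  fullSupport : ∀ μ ∈ K, (μ : Measure X).IsOpenPosMeasure
  good : IsGood K
  approxDivisible : IsApproxDivisible K

/-- The topology of uniform convergence on the homeomorphism group of a compact space
(the compact-open topology inherited from the space of continuous maps). -/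
instance homeoTopology (X : Type*) [TopologicalSpace X] : TopologicalSpace (X ≃ₜ X) :=
  TopologicalSpace.induced (fun h : X ≃ₜ X => (h : C(X, X))) inferInstance

/-- The group `G` of all homeomorphisms that preserve every measure of `K`. -/
def preservingGroup {X : Type*} [TopologicalSpace X] [MeasurableSpace X] [BorelSpace X]
    (K : Set (ProbabilityMeasure X)) : Subgroup (X ≃ₜ X) where
  carrier := {g | ∀ μ ∈ K, Measure.map g (μ : Measure X) = μ}
  one_mem' := fun μ _ => Measure.map_id
  mul_mem' := by
    intro a b ha hb μ hμ
    have h := Measure.map_map (μ := (μ : Measure X)) a.continuous.measurable b.continuous.measurable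
    rw [hb μ hμ, ha μ hμ] at h
    exact h.symm
  inv_mem' := by
    intro a ha μ hμ
    have h := Measure.map_map (μ := (μ : Measure X)) a.symm.continuous.measurable
      a.continuous.measurable
    rw [ha μ hμ, a.symm_comp_self, Measure.map_id] at h
    exact h

/-- The topological full group `[[g]]`: homeomorphisms that coincide with powers of `g` on the
pieces of a finite clopen partition. -/
def topologicalFullGroup {X : Type*} [TopologicalSpace X] (g : X ≃ₜ X) : Subgroup (X ≃ₜ X) where
  carrier := {h | ∃ (ι : Type) (_ : Finite ι) (A : ι → Set X) (n : ι → ℤ),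
    (∀ i, IsClopen (A i)) ∧ (Pairwise fun i j => Disjoint (A i) (A j)) ∧ (⋃ i, A i) = univ ∧
      ∀ i, ∀ x ∈ A i, h x = (g ^ n i) x}
  one_mem' := ⟨Unit, inferInstance, fun _ => univ, fun _ => 0, fun _ => isClopen_univ,
    fun i j h => (h rfl).elim, iUnion_const _, fun _ _ _ => rfl⟩
  mul_mem' := by
    rintro a b ⟨ι, hι, A, n, hA, hAd, hAu, hAn⟩ ⟨κ, hκ, B, m, hB, hBd, hBu, hBm⟩
    refine ⟨ι × κ, inferInstance, fun p => b ⁻¹' A p.1 ∩ B p.2, fun p => n p.1 + m p.2,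
      fun p => ((hA p.1).preimage b.continuous).inter (hB p.2), ?_, ?_, ?_⟩
    · rintro ⟨i, j⟩ ⟨i', j'⟩ hne
      by_cases hi : i = i'
      · have hj : j ≠ j' := fun hj => hne (by rw [hi, hj])
        exact (hBd hj).mono inter_subset_right inter_subset_right
      · exact ((hAd hi).preimage b).mono inter_subset_left inter_subset_left
    · refine eq_univ_of_forall fun x => ?_
      obtain ⟨i, hi⟩ := mem_iUnion.1 (hAu ▸ mem_univ (b x))
      obtain ⟨j, hj⟩ := mem_iUnion.1 (hBu ▸ mem_univ x)
      exact mem_iUnion.2 ⟨(i, j), hi, hj⟩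
    · rintro ⟨i, j⟩ x ⟨hi, hj⟩
      change a (b x) = _
      rw [hAn i _ hi, hBm j x hj, zpow_add]
      rfl
  inv_mem' := by
    rintro a ⟨ι, hι, A, n, hA, hAd, hAu, hAn⟩
    refine ⟨ι, hι, fun i => a.symm ⁻¹' A i, fun i => - n i,
      fun i => (hA i).preimage a.symm.continuous, fun i j h => (hAd h).preimage a.symm, ?_, ?_⟩
    · rw [← preimage_iUnion, hAu, preimage_univ]
    · intro i x hx
      have h := hAn i _ hx
      rw [a.apply_symm_apply] at h
      change a.symm x = _
      rw [zpow_neg]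
      exact ((g ^ n i).toEquiv.symm_apply_eq.2 h).symm

/-- A homeomorphism is minimal if all its orbits are dense. -/
def IsMinimalHomeo {X : Type*} [TopologicalSpace X] (g : X ≃ₜ X) : Prop :=
  ∀ x : X, Dense (Set.range fun n : ℤ => (g ^ n) x)

/-- `g` is a `K`-saturated element of `G`. -/
def IsSaturated {X : Type*} [TopologicalSpace X] [MeasurableSpace X] [BorelSpace X]
    (K : Set (ProbabilityMeasure X)) (g : X ≃ₜ X) : Prop :=
  g ∈ preservingGroup K ∧
    ∀ U V : Set X, IsClopen U → IsClopen V → KEquiv K U V →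
      ∃ h ∈ topologicalFullGroup g, h '' U = V

/-- A KR-partition: a finite partition of `X` into nonempty clopen atoms, arranged in columns;
the column `i` consists of the pairwise `K`-equivalent atoms `atom i 0, …, atom i (height i)`,
in this order. The values `atom i r` for `r > height i` are irrelevant. -/
structure KRPartition {X : Type*} [TopologicalSpace X] [MeasurableSpace X]
    (K : Set (ProbabilityMeasure X)) where
  Column : Type
  finite : Finite Column
  height : Column → ℕ
  atom : Column → ℕ → Set X
  isClopen : ∀ i, ∀ r ≤ height i, IsClopen (atom i r)
  nonempty : ∀ i, ∀ r ≤ height i, (atom i r).Nonempty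
  disjoint : ∀ i, ∀ r ≤ height i, ∀ j, ∀ s ≤ height j, (i ≠ j ∨ r ≠ s) →
    Disjoint (atom i r) (atom j s)
  cover : ∀ x, ∃ i, ∃ r ≤ height i, x ∈ atom i r
  equiv : ∀ i, ∀ r ≤ height i, ∀ s ≤ height i, KEquiv K (atom i r) (atom i s)

namespace KRPartition

/-- The base: the union of the lowest atoms of all columns. -/
def base {X : Type*} [TopologicalSpace X] [MeasurableSpace X] {K : Set (ProbabilityMeasure X)}
    (T : KRPartition K) : Set X :=
  ⋃ i, T.atom i 0

/-- The top: the union of the highest atoms of all columns. -/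
def top {X : Type*} [TopologicalSpace X] [MeasurableSpace X] {K : Set (ProbabilityMeasure X)}
    (T : KRPartition K) : Set X :=
  ⋃ i, T.atom i (T.height i)

/-- `S` refines `T`: base and top of `S` lie in base and top of `T`, and every column of `S` is
obtained by stacking subcolumns of columns `c 0, …, c m` of `T` on top of each other. -/
def Refines {X : Type*} [TopologicalSpace X] [MeasurableSpace X] {K : Set (ProbabilityMeasure X)}
    (S T : KRPartition K) : Prop :=
  S.base ⊆ T.base ∧ S.top ⊆ T.top ∧
    ∀ i : S.Column, ∃ (m : ℕ) (c : ℕ → T.Column),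
      S.height i + 1 = ∑ k ∈ Finset.range (m + 1), (T.height (c k) + 1) ∧
      ∀ k ≤ m, ∀ j ≤ T.height (c k),
        S.atom i (j + ∑ l ∈ Finset.range k, (T.height (c l) + 1)) ⊆ T.atom (c k) j

/-- `g` extends the partial automorphism of the algebra of clopen sets given by `T`: it maps every
atom that is not the highest of its column onto the next one, and the top onto the base. -/
def ExtendedBy {X : Type*} [TopologicalSpace X] [MeasurableSpace X]
    {K : Set (ProbabilityMeasure X)} (T : KRPartition K) (g : X ≃ₜ X) : Prop :=
  (∀ i, ∀ r < T.height i, g '' T.atom i r = T.atom i (r + 1)) ∧ g '' T.top = T.base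

end KRPartition

/-- `g` is the limit of the sequence `S` of KR-partitions, each refining the preceding one, whose
bases and tops have diameters that tend to zero: `g` is the one and only homeomorphism that extends
all the partial automorphisms given by the `S n`. -/
def IsLimitOfKRPartitions {X : Type*} [MetricSpace X] [MeasurableSpace X]
    {K : Set (ProbabilityMeasure X)} (S : ℕ → KRPartition K) (g : X ≃ₜ X) : Prop :=
  (∀ n, (S (n + 1)).Refines (S n)) ∧
    Tendsto (fun n => Metric.diam (S n).base) atTop (𝓝 0) ∧
    Tendsto (fun n => Metric.diam (S n).top) atTop (𝓝 0) ∧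
    ∀ h : X ≃ₜ X, (∀ n, (S n).ExtendedBy h) ↔ h = g

end DynSimplex

/-!
The saturated element is built as a limit of Kakutani–Rokhlin partitions, whose columns are handled
as lists of clopen sets. All partitions arise from two operations: cutting a column vertically
(`IsDynamicalSimplex.exists_cut`), which goodness and full support permit along any clopen part of
any atom, and stacking columns with equivalent atoms. `IsRefinement` is the resulting relation
between lists of weighted columns.

A pair `U`, `V` of equivalent clopen sets is treated as follows. After cutting, every atom lies in
`U` or its complement, and likewise for `V`. Give each column as weight the number of its atoms in
`U` minus the number of those in `V`. As `U` and `V` are equivalent, the sum over all columns of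
weight times mass of the base vanishes for all measures of `K`. The columns can then be cut and
stacked into columns of weight `0` (`IsDynamicalSimplex.exists_balanced`). This is the geometric
form of Shen's characterisation of dimension groups: if `m` is the maximal absolute value of a
weight and, up to a change of signs, `L` is a column of weight `m`, the vanishing sum shows that
the base of `L` has at most the mass of the union of the bases of the columns of negative weight.
So, by goodness, it is equivalent to a clopen subset of this union, and `L` is cut according to the
trace of this subset on each of these bases, each piece being stacked with the corresponding piece
of a column of negative weight. The number of columns of weight `m` decreases, and the procedure
terminates.

To make bases and tops small (`IsDynamicalSimplex.exists_small_ends`), a column `P` with small base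
and a column `Q` with small top, with equivalent atoms, are cut off. Approximate divisibility
reduces the total mass of the bases of the other columns below that of `P`; each of them is then
placed between a piece of `P` and a piece of `Q`.

All pairs of clopen sets are treated in turn. The partitions so obtained define closed
relations on `X`, whose intersection is the graph of a homeomorphism `g` because every clopen set
is eventually a union of atoms and the bases and tops shrink to points (`exists_limit`). When `U`
and `V` meet every column in the same number of atoms, a permutation of the atoms of each column,
effected by powers of `g`, maps `U` to `V` (`exists_image_eq`); hence `g` is saturated.

For a saturated element, minimality follows since a small clopen neighbourhood of any point
can be mapped by an element of `[[g]]` into any nonempty clopen set, and density of `[[g]]` since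
the restrictions of `h ∈ G` to small clopen pieces can be matched by elements of `[[g]]`, which are
then glued (`exists_glue`).
-/

namespace DynSimplex

/-! ### Masses of clopen sets -/

section Measure

variable {X : Type*} [MeasurableSpace X] {K : Set (ProbabilityMeasure X)}

theorem KEquiv.symm {A B : Set X} (h : KEquiv K A B) : KEquiv K B A :=
  fun μ hμ => (h μ hμ).symm

theorem KEquiv.trans {A B C : Set X} (h : KEquiv K A B) (h' : KEquiv K B C) : KEquiv K A C :=
  fun μ hμ => (h μ hμ).trans (h' μ hμ)

theorem real_mono (μ : ProbabilityMeasure X) {A B : Set X} (h : A ⊆ B) : (μ A : ℝ) ≤ μ B :=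
  NNReal.coe_le_coe.2 (μ.apply_mono h)

theorem real_le_one (μ : ProbabilityMeasure X) (A : Set X) : (μ A : ℝ) ≤ 1 := by
  exact_mod_cast μ.apply_le_one A

theorem real_empty (μ : ProbabilityMeasure X) : (μ ∅ : ℝ) = 0 := by simp

theorem kEquiv_iff {A B : Set X} : KEquiv K A B ↔ ∀ μ ∈ K, (μ A : ℝ) = μ B :=
  forall₂_congr fun _ _ => NNReal.coe_inj.symm

theorem KEquiv.real {A B : Set X} (h : KEquiv K A B) {μ : ProbabilityMeasure X} (hμ : μ ∈ K) :
    (μ A : ℝ) = μ B :=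
  kEquiv_iff.1 h μ hμ

variable [MetricSpace X] [BorelSpace X]

theorem real_union (μ : ProbabilityMeasure X) {A B : Set X} (h : Disjoint A B) (hB : IsClopen B) :
    (μ (A ∪ B) : ℝ) = μ A + μ B := by
  have := measureReal_union (μ := (μ : Measure X)) h hB.isClosed.measurableSet
  exact this

theorem real_diff (μ : ProbabilityMeasure X) {A B : Set X} (h : B ⊆ A) (hB : IsClopen B) :
    (μ (A \ B) : ℝ) = μ A - μ B := by
  have := real_union μ (disjoint_sdiff_left (s := B) (t := A)) hB
  rw [sdiff_union_of_subset h] at this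
  linarith

theorem KEquiv.diff {A B A' B' : Set X} (h : KEquiv K A B) (h' : KEquiv K A' B')
    (hA : A' ⊆ A) (hB : B' ⊆ B) (hA' : IsClopen A') (hB' : IsClopen B') :
    KEquiv K (A \ A') (B \ B') :=
  kEquiv_iff.2 fun μ hμ => by
    rw [real_diff μ hA hA', real_diff μ hB hB', h.real hμ, h'.real hμ]

theorem continuous_real {A : Set X} (hA : IsClopen A) :
    Continuous fun μ : ProbabilityMeasure X => (μ A : ℝ) :=
  NNReal.continuous_coe.comp (continuous_iff_continuousAt.2 fun _ =>
    ProbabilityMeasure.tendsto_measure_of_isClopen_of_tendsto tendsto_id hA)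

variable (hK : IsDynamicalSimplex K)
include hK

theorem IsDynamicalSimplex.real_pos {A : Set X} (hA : IsClopen A) (hne : A.Nonempty)
    {μ : ProbabilityMeasure X} (hμ : μ ∈ K) : 0 < (μ A : ℝ) := by
  have := hK.fullSupport μ hμ
  have h := hA.isOpen.measure_pos (μ : Measure X) hne
  have : (μ A : ℝ) = ((μ : Measure X) A).toReal := rfl
  rw [this]
  exact ENNReal.toReal_pos h.ne' (measure_ne_top _ _)

theorem IsDynamicalSimplex.eq_empty_of_kEquiv {A : Set X} (hA : IsClopen A)
    (h : KEquiv K A ∅) : A = ∅ := by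
  by_contra hne
  obtain ⟨μ, hμ⟩ := hK.nonempty
  have := hK.real_pos hA (nonempty_iff_ne_empty.2 hne) hμ
  rw [h.real hμ, real_empty] at this
  exact this.false

/-- Goodness, in real-valued form. -/
theorem IsDynamicalSimplex.exists_subset_of_lt {A B : Set X} (hA : IsClopen A) (hB : IsClopen B)
    (h : ∀ μ ∈ K, (μ A : ℝ) < μ B) : ∃ C ⊆ B, IsClopen C ∧ KEquiv K C A := by
  obtain ⟨C, hC, hCB, hCA⟩ := hK.good A B hA hB fun μ hμ => NNReal.coe_lt_coe.1 (h μ hμ)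
  exact ⟨C, hCB, hC, hCA⟩

/-- A clopen piece of `B` can be copied into any clopen set equivalent to `B`. The strict
inequality that goodness asks for holds unless the piece is all of `B`, by full support. -/
theorem IsDynamicalSimplex.transport {A B D : Set X} (hA : IsClopen A) (hB : IsClopen B)
    (h : KEquiv K A B) (hD : IsClopen D) (hDB : D ⊆ B) : ∃ C ⊆ A, IsClopen C ∧ KEquiv K C D := by
  by_cases hne : (B \ D).Nonempty
  · refine hK.exists_subset_of_lt hD hA fun μ hμ => ?_
    have := hK.real_pos (hB.diff hD) hne hμ
    rw [real_diff μ hDB hD] at this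
    rw [h.real hμ]
    linarith
  · have : D = B := hDB.antisymm (sdiff_eq_empty.1 (not_nonempty_iff_eq_empty.1 hne))
    exact ⟨A, subset_rfl, hA, this ▸ h⟩

/-- A uniform lower bound for the masses of a nonempty clopen set. -/
theorem IsDynamicalSimplex.exists_pos_le {A : Set X} (hA : IsClopen A) (hne : A.Nonempty) :
    ∃ δ > 0, ∀ μ ∈ K, δ ≤ (μ A : ℝ) := by
  obtain ⟨μ, hμ, hmin⟩ := hK.isCompact.exists_isMinOn hK.nonempty (continuous_real hA).continuousOn
  exact ⟨_, hK.real_pos hA hne hμ, fun ν hν => hmin hν⟩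

/-- A Dini type argument: as the measures of the compact set `K` have no atoms, the clopen
neighbourhoods of a point become uniformly small. -/
theorem IsDynamicalSimplex.exists_small [CompactSpace X] [TotallyDisconnectedSpace X]
    {U : Set X} (hU : IsClopen U) (hne : U.Nonempty) {x : X} {O : Set X} (hO : IsOpen O)
    (hx : x ∈ O) :
    ∃ V ⊆ O, IsClopen V ∧ x ∈ V ∧ ∀ μ ∈ K, (μ V : ℝ) < μ U := by
  refine hK.isCompact.induction_on
    (p := fun s => ∃ V ⊆ O, IsClopen V ∧ x ∈ V ∧ ∀ μ ∈ s, (μ V : ℝ) < μ U) ?_ ?_ ?_ ?_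
  · obtain ⟨V, hV, hxV, hVO⟩ := compact_exists_isClopen_in_isOpen hO hx
    exact ⟨V, hVO, hV, hxV, by simp⟩
  · rintro s t hst ⟨V, h1, h2, h3, h4⟩
    exact ⟨V, h1, h2, h3, fun μ hμ => h4 μ (hst hμ)⟩
  · rintro s t ⟨V, h1, h2, h3, h4⟩ ⟨W, g1, g2, g3, g4⟩
    refine ⟨V ∩ W, inter_subset_left.trans h1, h2.inter g2, ⟨h3, g3⟩, ?_⟩
    rintro μ (hμ | hμ)
    · exact (real_mono μ inter_subset_left).trans_lt (h4 μ hμ)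
    · exact (real_mono μ inter_subset_right).trans_lt (g4 μ hμ)
  · intro μ hμ
    have := hK.atomless μ hμ
    have hlt : (μ : Measure X) {x} < (μ : Measure X) U := by
      rw [measure_singleton]
      have := hK.fullSupport μ hμ
      exact hU.isOpen.measure_pos _ hne
    obtain ⟨W, hxW, hW, hWlt⟩ := Set.exists_isOpen_lt_of_lt _ _ hlt
    obtain ⟨V, hV, hxV, hVO⟩ := compact_exists_isClopen_in_isOpen (hO.inter hW)
      ⟨hx, hxW (mem_singleton x)⟩
    refine ⟨{ν | (ν V : ℝ) < ν U}, ?_, V, hVO.trans inter_subset_left, hV, hxV, fun ν hν => hν⟩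
    refine mem_nhdsWithin_of_mem_nhds
      ((isOpen_lt (continuous_real hV) (continuous_real hU)).mem_nhds ?_)
    have h2 : (μ : Measure X) V < (μ : Measure X) U :=
      (measure_mono (hVO.trans inter_subset_right)).trans_lt hWlt
    exact (ENNReal.toReal_lt_toReal (measure_ne_top _ _) (measure_ne_top _ _)).2 h2

end Measure

/-! ### Weighted columns, stacking and refinement -/

section Tower

variable {X : Type*}

/-- The number of entries of the list `L` of sets that contain the point `x`. -/
noncomputable def mult (L : List (Set X)) (x : X) : ℕ :=
  (L.map fun A => A.indicator (fun _ => 1) x).sum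

/-- The number of atoms of the columns of `W` that contain `x`, counted with multiplicity. A list
of columns partitions the space if this number is always `1`. -/
noncomputable def totalMult (W : List (ℤ × List (Set X))) (x : X) : ℕ :=
  (W.map fun p => mult p.2 x).sum

/-- The lowest atom of a column (a list of atoms, from bottom to top). -/
def baseAtom (L : List (Set X)) : Set X := L.headD ∅

/-- The highest atom of a column. -/
def topAtom (L : List (Set X)) : Set X := L.getLastD ∅

/-- `Stack W m L` holds if the column `L` is a concatenation of at least one subcolumn of the
columns of `W`, and `m` is the sum of the weights of the columns used. -/
inductive Stack (W : List (ℤ × List (Set X))) : ℤ → List (Set X) → Prop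
  | block {m : ℤ} {L N : List (Set X)} (hN : (m, N) ∈ W)
      (hL : List.Forall₂ (fun A B => A ⊆ B) L N) : Stack W m L
  | append {m₁ m₂ : ℤ} {L₁ L₂ : List (Set X)} (h₁ : Stack W m₁ L₁) (h₂ : Stack W m₂ L₂) :
      Stack W (m₁ + m₂) (L₁ ++ L₂)

@[simp] theorem mult_nil (x : X) : mult [] x = 0 := rfl

@[simp] theorem mult_cons (A : Set X) (L : List (Set X)) (x : X) :
    mult (A :: L) x = A.indicator (fun _ => 1) x + mult L x := by
  simp [mult]

@[simp] theorem mult_append (L L' : List (Set X)) (x : X) :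
    mult (L ++ L') x = mult L x + mult L' x := by
  simp [mult]

@[simp] theorem totalMult_nil (x : X) : totalMult [] x = 0 := rfl

@[simp] theorem totalMult_cons (p : ℤ × List (Set X)) (W : List (ℤ × List (Set X))) (x : X) :
    totalMult (p :: W) x = mult p.2 x + totalMult W x := by
  simp [totalMult]

@[simp] theorem totalMult_append (W W' : List (ℤ × List (Set X))) (x : X) :
    totalMult (W ++ W') x = totalMult W x + totalMult W' x := by
  simp [totalMult]

theorem totalMult_perm {W W' : List (ℤ × List (Set X))} (h : W.Perm W') (x : X) :
    totalMult W x = totalMult W' x :=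
  (h.map _).sum_eq

theorem mult_split (L : List (Set X)) (c : Set X → Set X) (hc : ∀ B ∈ L, c B ⊆ B) (x : X) :
    mult (L.map c) x + mult (L.map fun B => B \ c B) x = mult L x := by
  induction L with
  | nil => rfl
  | cons A L ih =>
    have hA : (c A).indicator (fun _ => 1) x + (A \ c A).indicator (fun _ => 1) x =
        A.indicator (fun _ => 1) x := by
      have := hc A (by simp)
      by_cases h1 : x ∈ c A
      · simp [h1, this h1]
      · by_cases h2 : x ∈ A <;> simp [h1, h2]
    have := ih fun B hB => hc B (by simp [hB])
    simp only [List.map_cons, mult_cons]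
    omega

theorem mult_eq_zero {L : List (Set X)} (h : ∀ A ∈ L, A = ∅) (x : X) : mult L x = 0 := by
  induction L with
  | nil => rfl
  | cons A L ih =>
    rw [mult_cons, ih fun B hB => h B (by simp [hB]), h A (by simp)]
    simp

theorem baseAtom_mem {L : List (Set X)} (h : L ≠ []) : baseAtom L ∈ L := by
  cases L with
  | nil => exact (h rfl).elim
  | cons A L => simp [baseAtom]

theorem topAtom_eq_getLast {L : List (Set X)} (h : L ≠ []) : topAtom L = L.getLast h := by
  simp [topAtom, List.getLastD_eq_getLast?, List.getLast?_eq_getLast_of_ne_nil h]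

theorem topAtom_mem {L : List (Set X)} (h : L ≠ []) : topAtom L ∈ L := by
  rw [topAtom_eq_getLast h]
  exact List.getLast_mem h

theorem baseAtom_append {L L' : List (Set X)} (h : L ≠ []) :
    baseAtom (L ++ L') = baseAtom L := by
  cases L with
  | nil => exact (h rfl).elim
  | cons A L => simp [baseAtom]

theorem topAtom_append {L L' : List (Set X)} (h : L' ≠ []) :
    topAtom (L ++ L') = topAtom L' := by
  rw [topAtom_eq_getLast h, topAtom_eq_getLast (by simp [h]), List.getLast_append_of_ne_nil _ h]

theorem baseAtom_map {L : List (Set X)} (h : L ≠ []) (c : Set X → Set X) :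
    baseAtom (L.map c) = c (baseAtom L) := by
  cases L with
  | nil => exact (h rfl).elim
  | cons A L => simp [baseAtom]

theorem topAtom_map {L : List (Set X)} (h : L ≠ []) (c : Set X → Set X) :
    topAtom (L.map c) = c (topAtom L) := by
  rw [topAtom_eq_getLast h, topAtom_eq_getLast (by simp [h]), List.getLast_map]

theorem forall₂_subset_rfl (L : List (Set X)) : List.Forall₂ (fun A B => A ⊆ B) L L :=
  List.forall₂_same.2 fun _ _ => subset_rfl

theorem forall₂_map_subset {L : List (Set X)} {c : Set X → Set X} (hc : ∀ B ∈ L, c B ⊆ B) :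
    List.Forall₂ (fun A B => A ⊆ B) (L.map c) L :=
  List.forall₂_map_left_iff.2 (List.forall₂_same.2 hc)

theorem forall₂_subset_trans {L M N : List (Set X)} (h : List.Forall₂ (fun A B => A ⊆ B) L M)
    (h' : List.Forall₂ (fun A B => A ⊆ B) M N) : List.Forall₂ (fun A B => A ⊆ B) L N := by
  induction h generalizing N with
  | nil => exact h'
  | cons hab _ ih =>
    cases h' with
    | cons hbc h' => exact .cons (hab.trans hbc) (ih h')

theorem forall₂_exists_superset {L N : List (Set X)} (h : List.Forall₂ (fun A B => A ⊆ B) L N) :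
    ∀ A ∈ L, ∃ B ∈ N, A ⊆ B := by
  induction h with
  | nil => simp
  | cons hab _ ih =>
    intro A hA
    rcases List.mem_cons.1 hA with rfl | hA
    · exact ⟨_, by simp, hab⟩
    · obtain ⟨B, hB, h⟩ := ih A hA
      exact ⟨B, by simp [hB], h⟩

namespace Stack

variable {W W' : List (ℤ × List (Set X))} {m : ℤ} {L L' : List (Set X)}

theorem of_mem (h : (m, L) ∈ W) : Stack W m L :=
  block h (forall₂_subset_rfl L)

theorem of_subset (h : Stack W m L) (hL : List.Forall₂ (fun A B => A ⊆ B) L' L) :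
    Stack W m L' := by
  induction h generalizing L' with
  | block hN h => exact block hN (forall₂_subset_trans hL h)
  | append _ _ ih₁ ih₂ =>
    rw [← List.take_append_drop (List.length _) L']
    exact append (ih₁ (List.forall₂_take_append _ _ _ hL)) (ih₂ (List.forall₂_drop_append _ _ _ hL))

theorem trans (h : Stack W' m L) (hW : ∀ p ∈ W', Stack W p.1 p.2) : Stack W m L := by
  induction h with
  | block hN h => exact (hW _ hN).of_subset h
  | append _ _ ih₁ ih₂ => exact append ih₁ ih₂

theorem mono (h : Stack W' m L) (hW : W' ⊆ W) : Stack W m L :=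
  h.trans fun _ hp => of_mem (hW hp)

/-- Stacking, with the weights forgotten, is transitive. -/
theorem trans' (h : Stack W' m L) (hW : ∀ p ∈ W', ∃ m', Stack W m' p.2) : ∃ m', Stack W m' L := by
  induction h with
  | block hN h =>
    obtain ⟨m', h'⟩ := hW _ hN
    exact ⟨m', h'.of_subset h⟩
  | append _ _ ih₁ ih₂ =>
    obtain ⟨m₁, h₁⟩ := ih₁
    obtain ⟨m₂, h₂⟩ := ih₂
    exact ⟨_, append h₁ h₂⟩

/-- Reversing the sign of all weights. -/
theorem neg (h : Stack W m L) : Stack (W.map fun p => (-p.1, p.2)) (-m) L := by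
  induction h with
  | @block m L N hN h => exact block (List.mem_map.2 ⟨(m, N), hN, rfl⟩) h
  | append _ _ ih₁ ih₂ =>
    rw [neg_add]
    exact append ih₁ ih₂

theorem exists_superset (h : Stack W m L) : ∀ A ∈ L, ∃ p ∈ W, ∃ B ∈ p.2, A ⊆ B := by
  induction h with
  | block hN h =>
    intro A hA
    obtain ⟨B, hB, hAB⟩ := forall₂_exists_superset h A hA
    exact ⟨_, hN, B, hB, hAB⟩
  | append _ _ ih₁ ih₂ =>
    intro A hA
    rcases List.mem_append.1 hA with hA | hA
    exacts [ih₁ A hA, ih₂ A hA]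

theorem ne_nil (h : Stack W m L) (hW : ∀ p ∈ W, p.2 ≠ []) : L ≠ [] := by
  induction h with
  | block hN h =>
    rintro rfl
    exact hW _ hN (List.forall₂_nil_left_iff.1 h)
  | append _ _ ih₁ _ => simp [ih₁]

theorem baseAtom_subset (h : Stack W m L) (hW : ∀ p ∈ W, p.2 ≠ []) :
    ∃ p ∈ W, baseAtom L ⊆ baseAtom p.2 := by
  induction h with
  | block hN h =>
    refine ⟨_, hN, ?_⟩
    cases h with
    | nil => exact subset_rfl
    | cons h _ => exact h
  | append h₁ _ ih₁ _ => rwa [baseAtom_append (h₁.ne_nil hW)]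

theorem topAtom_subset (h : Stack W m L) (hW : ∀ p ∈ W, p.2 ≠ []) :
    ∃ p ∈ W, topAtom L ⊆ topAtom p.2 := by
  induction h with
  | @block m L N hN h =>
    refine ⟨_, hN, ?_⟩
    have hne : N ≠ [] := hW _ hN
    have hne' : L ≠ [] := (block hN h).ne_nil hW
    have hlen := h.length_eq
    rw [topAtom_eq_getLast hne, topAtom_eq_getLast hne', List.getLast_eq_getElem,
      List.getLast_eq_getElem]
    have := List.Forall₂.get h (i := L.length - 1)
      (by have := List.length_pos_iff.2 hne'; omega)
      (by have := List.length_pos_iff.2 hne'; omega)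
    simpa [hlen] using this
  | append _ h₂ _ ih₂ => rwa [topAtom_append (h₂.ne_nil hW)]

end Stack

variable [TopologicalSpace X] [MeasurableSpace X] {K : Set (ProbabilityMeasure X)}

/-- The list `L` is a column: a nonempty list of pairwise `K`-equivalent clopen sets. The sets may
be empty, and disjointness is imposed only on whole partitions, through `totalMult`. -/
structure IsColumn (K : Set (ProbabilityMeasure X)) (L : List (Set X)) : Prop where
  ne_nil : L ≠ []
  isClopen : ∀ A ∈ L, IsClopen A
  equiv : ∀ A ∈ L, ∀ B ∈ L, KEquiv K A B

/-- `W'` consists of columns that are obtained by cutting and stacking the weighted columns of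
`W`, in such a way that every point is covered as often as before. -/
structure IsRefinement (K : Set (ProbabilityMeasure X)) (W' W : List (ℤ × List (Set X))) :
    Prop where
  column : ∀ p ∈ W', IsColumn K p.2
  stack : ∀ p ∈ W', Stack W p.1 p.2
  totalMult_eq : ∀ x, totalMult W' x = totalMult W x

theorem IsColumn.equiv_base {L : List (Set X)} (hL : IsColumn K L) {A : Set X} (hA : A ∈ L) :
    KEquiv K A (baseAtom L) :=
  hL.equiv A hA _ (baseAtom_mem hL.ne_nil)

theorem IsColumn.isClopen_base {L : List (Set X)} (hL : IsColumn K L) : IsClopen (baseAtom L) :=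
  hL.isClopen _ (baseAtom_mem hL.ne_nil)

theorem IsColumn.append {L L' : List (Set X)} (hL : IsColumn K L) (hL' : IsColumn K L')
    (h : KEquiv K (baseAtom L) (baseAtom L')) : IsColumn K (L ++ L') := by
  have key : ∀ A ∈ L ++ L', KEquiv K A (baseAtom L') := by
    intro A hA
    rcases List.mem_append.1 hA with hA | hA
    exacts [(hL.equiv_base hA).trans h, hL'.equiv_base hA]
  refine ⟨by simp [hL.ne_nil], ?_, fun A hA B hB => (key A hA).trans (key B hB).symm⟩
  intro A hA
  rcases List.mem_append.1 hA with hA | hA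
  exacts [hL.isClopen A hA, hL'.isClopen A hA]

namespace IsRefinement

variable {W W' W'' V V' : List (ℤ × List (Set X))}

theorem refl (hW : ∀ p ∈ W, IsColumn K p.2) : IsRefinement K W W :=
  ⟨hW, fun _ hp => .of_mem hp, fun _ => rfl⟩

theorem trans (h : IsRefinement K W'' W') (h' : IsRefinement K W' W) : IsRefinement K W'' W :=
  ⟨h.column, fun p hp => (h.stack p hp).trans h'.stack,
    fun x => (h.totalMult_eq x).trans (h'.totalMult_eq x)⟩

theorem append (h : IsRefinement K W' W) (h' : IsRefinement K V' V) :
    IsRefinement K (W' ++ V') (W ++ V) := by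
  refine ⟨?_, ?_, fun x => by simp [h.totalMult_eq, h'.totalMult_eq]⟩
  · intro p hp
    rcases List.mem_append.1 hp with hp | hp
    exacts [h.column p hp, h'.column p hp]
  · intro p hp
    rcases List.mem_append.1 hp with hp | hp
    exacts [(h.stack p hp).mono (by simp), (h'.stack p hp).mono (by simp)]

theorem perm_right (h : IsRefinement K W' W) (hp : W.Perm V) : IsRefinement K W' V :=
  ⟨h.column, fun p hp' => (h.stack p hp').mono hp.subset,
    fun x => (h.totalMult_eq x).trans (totalMult_perm hp x)⟩

/-- Cutting a column vertically into two. -/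
theorem split {m : ℤ} {L : List (Set X)} {c : Set X → Set X} (hc : ∀ B ∈ L, c B ⊆ B)
    (h₁ : IsColumn K (L.map c)) (h₂ : IsColumn K (L.map fun B => B \ c B)) :
    IsRefinement K [(m, L.map c), (m, L.map fun B => B \ c B)] [(m, L)] := by
  refine ⟨by simp [h₁, h₂], ?_, fun x => by simpa using mult_split L c hc x⟩
  simp only [List.mem_cons, List.not_mem_nil, or_false, forall_eq_or_imp, forall_eq]
  exact ⟨.block (List.mem_singleton_self _) (forall₂_map_subset hc),
    .block (List.mem_singleton_self _) (forall₂_map_subset fun _ _ => sdiff_subset)⟩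

/-- Putting one column on top of another. -/
theorem stacking {m m' : ℤ} {L L' : List (Set X)} (h : IsColumn K (L ++ L')) :
    IsRefinement K [(m + m', L ++ L')] [(m, L), (m', L')] := by
  refine ⟨by simp [h], ?_, fun x => by simp⟩
  simp only [List.mem_singleton, forall_eq]
  exact .append (.of_mem (by simp)) (.of_mem (by simp))

theorem drop {m : ℤ} {L : List (Set X)} (h : ∀ A ∈ L, A = ∅) : IsRefinement K [] [(m, L)] :=
  ⟨by simp, by simp, fun x => by simp [mult_eq_zero h x]⟩

theorem neg (h : IsRefinement K W' W) :
    IsRefinement K (W'.map fun p => (-p.1, p.2)) (W.map fun p => (-p.1, p.2)) := by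
  refine ⟨?_, ?_, ?_⟩
  · intro p hp
    obtain ⟨q, hq, rfl⟩ := List.mem_map.1 hp
    exact h.column q hq
  · intro p hp
    obtain ⟨q, hq, rfl⟩ := List.mem_map.1 hp
    exact (h.stack q hq).neg
  · intro x
    simpa [totalMult, Function.comp_def] using h.totalMult_eq x

end IsRefinement

end Tower

section Cutting

variable {X : Type*} [MetricSpace X] [MeasurableSpace X] [BorelSpace X]
  {K : Set (ProbabilityMeasure X)} (hK : IsDynamicalSimplex K)
include hK

/-- A column can be cut along any clopen part `D` of any one of its atoms. The parts of the other
atoms are recorded by a choice function `c` on sets. -/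
theorem IsDynamicalSimplex.exists_cut {L : List (Set X)} (hL : IsColumn K L) {A D : Set X}
    (hA : A ∈ L) (hD : IsClopen D) (hDA : D ⊆ A) :
    ∃ c : Set X → Set X, c A = D ∧ (∀ B ∈ L, c B ⊆ B) ∧ (∀ B ∈ L, KEquiv K (c B) D) ∧
      IsColumn K (L.map c) ∧ IsColumn K (L.map fun B => B \ c B) := by
  classical
  have key : ∀ B : Set X, ∃ C : Set X, (B = A → C = D) ∧
      (B ∈ L → C ⊆ B ∧ IsClopen C ∧ KEquiv K C D) := by
    intro B
    by_cases hBA : B = A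
    · subst hBA
      exact ⟨D, fun _ => rfl, fun _ => ⟨hDA, hD, fun _ _ => rfl⟩⟩
    · by_cases hB : B ∈ L
      · obtain ⟨C, h1, h2, h3⟩ :=
          hK.transport (hL.isClopen B hB) (hL.isClopen A hA) (hL.equiv B hB A hA) hD hDA
        exact ⟨C, fun h => (hBA h).elim, fun _ => ⟨h1, h2, h3⟩⟩
      · exact ⟨∅, fun h => (hBA h).elim, fun h => (hB h).elim⟩
  choose c hcA hc using key
  refine ⟨c, hcA A rfl, fun B hB => (hc B hB).1, fun B hB => (hc B hB).2.2, ?_, ?_⟩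
  · refine ⟨by simp [hL.ne_nil], ?_, ?_⟩ <;> simp only [List.forall_mem_map]
    · exact fun B hB => (hc B hB).2.1
    · exact fun B hB C hC => (hc B hB).2.2.trans (hc C hC).2.2.symm
  · refine ⟨by simp [hL.ne_nil], ?_, ?_⟩ <;> simp only [List.forall_mem_map]
    · exact fun B hB => (hL.isClopen B hB).diff (hc B hB).2.1
    · exact fun B hB C hC => (hL.equiv B hB C hC).diff
        ((hc B hB).2.2.trans (hc C hC).2.2.symm) (hc B hB).1 (hc C hC).1 (hc B hB).2.1 (hc C hC).2.1

theorem IsDynamicalSimplex.eq_empty_of_column {L : List (Set X)} (hL : IsColumn K L) {A : Set X}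
    (hA : A ∈ L) (h : A = ∅) : ∀ B ∈ L, B = ∅ :=
  fun B hB => hK.eq_empty_of_kEquiv (hL.isClopen B hB) (h ▸ hL.equiv B hB A hA)

end Cutting

/-! ### Balancing weighted columns -/

section Weights

variable {X : Type*}

/-- The union of the bases of the columns of `W`. -/
def baseUnion (W : List (ℤ × List (Set X))) : Set X := {x | ∃ p ∈ W, x ∈ baseAtom p.2}

theorem baseUnion_cons (p : ℤ × List (Set X)) (W : List (ℤ × List (Set X))) :
    baseUnion (p :: W) = baseAtom p.2 ∪ baseUnion W := by
  ext x
  simp [baseUnion]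

theorem one_le_mult {L : List (Set X)} {A : Set X} (hA : A ∈ L) {x : X} (hx : x ∈ A) :
    1 ≤ mult L x := by
  have := List.single_le_sum (l := L.map fun A => A.indicator (fun _ => 1) x)
    (fun _ _ => Nat.zero_le _) _ (List.mem_map_of_mem hA)
  simp only [indicator_of_mem hx] at this
  exact this

theorem one_le_totalMult {W : List (ℤ × List (Set X))} {p : ℤ × List (Set X)} (hp : p ∈ W)
    {A : Set X} (hA : A ∈ p.2) {x : X} (hx : x ∈ A) : 1 ≤ totalMult W x :=
  (one_le_mult hA hx).trans (List.single_le_sum (l := W.map fun p => mult p.2 x)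
    (fun _ _ => Nat.zero_le _) _ (List.mem_map_of_mem (f := fun p => mult p.2 x) hp))

variable [MeasurableSpace X] {K : Set (ProbabilityMeasure X)}

/-- The sum over all columns of weight times mass of the base: the integral of the function that
is constant equal to the weight on the base of each column. -/
noncomputable def weightSum (μ : ProbabilityMeasure X) (W : List (ℤ × List (Set X))) : ℝ :=
  (W.map fun p => (p.1 : ℝ) * μ (baseAtom p.2)).sum

/-- The total mass of the bases of the columns of `W`. -/
noncomputable def baseSum (μ : ProbabilityMeasure X) (W : List (ℤ × List (Set X))) : ℝ :=
  (W.map fun p => (μ (baseAtom p.2) : ℝ)).sum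

@[simp] theorem weightSum_nil (μ : ProbabilityMeasure X) : weightSum μ [] = 0 := rfl

@[simp] theorem weightSum_cons (μ : ProbabilityMeasure X) (p : ℤ × List (Set X))
    (W : List (ℤ × List (Set X))) :
    weightSum μ (p :: W) = p.1 * μ (baseAtom p.2) + weightSum μ W := by
  simp [weightSum]

@[simp] theorem weightSum_append (μ : ProbabilityMeasure X) (W W' : List (ℤ × List (Set X))) :
    weightSum μ (W ++ W') = weightSum μ W + weightSum μ W' := by
  simp [weightSum]

theorem weightSum_perm (μ : ProbabilityMeasure X) {W W' : List (ℤ × List (Set X))}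
    (h : W.Perm W') : weightSum μ W = weightSum μ W' :=
  (h.map _).sum_eq

theorem weightSum_neg (μ : ProbabilityMeasure X) (W : List (ℤ × List (Set X))) :
    weightSum μ (W.map fun p => (-p.1, p.2)) = -weightSum μ W := by
  induction W with
  | nil => simp
  | cons p W ih =>
    rw [List.map_cons, weightSum_cons, weightSum_cons, ih]
    push_cast
    ring

@[simp] theorem baseSum_nil (μ : ProbabilityMeasure X) : baseSum μ [] = 0 := rfl

@[simp] theorem baseSum_cons (μ : ProbabilityMeasure X) (p : ℤ × List (Set X))
    (W : List (ℤ × List (Set X))) :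
    baseSum μ (p :: W) = μ (baseAtom p.2) + baseSum μ W := by
  simp [baseSum]

@[simp] theorem baseSum_append (μ : ProbabilityMeasure X) (W W' : List (ℤ × List (Set X))) :
    baseSum μ (W ++ W') = baseSum μ W + baseSum μ W' := by
  simp [baseSum]

theorem baseSum_nonneg (μ : ProbabilityMeasure X) (W : List (ℤ × List (Set X))) :
    0 ≤ baseSum μ W := by
  refine List.sum_nonneg ?_
  simp only [List.forall_mem_map]
  exact fun _ _ => NNReal.coe_nonneg _

variable [TopologicalSpace X]

theorem isClopen_baseUnion {W : List (ℤ × List (Set X))} (hW : ∀ p ∈ W, IsColumn K p.2) :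
    IsClopen (baseUnion W) := by
  induction W with
  | nil =>
    have : baseUnion ([] : List (ℤ × List (Set X))) = ∅ := by ext; simp [baseUnion]
    rw [this]
    exact isClopen_empty
  | cons p W ih =>
    rw [baseUnion_cons]
    exact (hW p (by simp)).isClopen_base.union (ih fun q hq => hW q (by simp [hq]))

end Weights

section Balance

variable {X : Type*} [MetricSpace X] [MeasurableSpace X] [BorelSpace X]
  {K : Set (ProbabilityMeasure X)}

theorem real_baseUnion (μ : ProbabilityMeasure X) {W : List (ℤ × List (Set X))}
    (hW : ∀ p ∈ W, IsColumn K p.2) (hd : ∀ x, totalMult W x ≤ 1) :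
    (μ (baseUnion W) : ℝ) = baseSum μ W := by
  induction W with
  | nil =>
    have : baseUnion ([] : List (ℤ × List (Set X))) = ∅ := by ext; simp [baseUnion]
    simp [this]
  | cons p W ih =>
    have hW' : ∀ q ∈ W, IsColumn K q.2 := fun q hq => hW q (by simp [hq])
    rw [baseUnion_cons, real_union μ _ (isClopen_baseUnion hW'), baseSum_cons, ih hW']
    · intro x
      have := hd x
      rw [totalMult_cons] at this
      omega
    · rw [Set.disjoint_left]
      rintro x hx ⟨q, hq, hxq⟩
      have h1 := hd x
      have h2 := one_le_mult (baseAtom_mem (hW p (by simp)).ne_nil) hx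
      have h3 := one_le_totalMult hq (baseAtom_mem (hW' q hq).ne_nil) hxq
      rw [totalMult_cons] at h1
      omega

variable (hK : IsDynamicalSimplex K)
include hK

/-- If the base of `L` is equivalent to a clopen set `C` that is covered by the bases of the
columns in `N`, then `L` can be cut into pieces that correspond to the traces of `C` on these
bases, and each piece can be put below the corresponding piece of a column of `N`. -/
theorem IsDynamicalSimplex.distribute (N : List (ℤ × List (Set X))) :
    ∀ (m : ℤ) (L : List (Set X)) (C : Set X), IsColumn K L → (∀ p ∈ N, IsColumn K p.2) →
      IsClopen C → C ⊆ baseUnion N → KEquiv K (baseAtom L) C →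
      ∃ W, IsRefinement K W ((m, L) :: N) ∧ (∀ q ∈ W, ∃ p ∈ N, q.1 = p.1 ∨ q.1 = m + p.1) ∧
        ∀ μ ∈ K, weightSum μ W = weightSum μ ((m, L) :: N) := by
  induction N with
  | nil =>
    intro m L C hL _ hC hCN hLC
    have hC0 : C = ∅ := subset_empty_iff.1 (hCN.trans fun x hx => by simp [baseUnion] at hx)
    have hL0 := hK.eq_empty_of_kEquiv hL.isClopen_base (hC0 ▸ hLC)
    refine ⟨[], IsRefinement.drop (hK.eq_empty_of_column hL (baseAtom_mem hL.ne_nil) hL0),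
      by simp, ?_⟩
    simp [hL0]
  | cons p N ih =>
    obtain ⟨f, M⟩ := p
    intro m L C hL hN hC hCN hLC
    have hM : IsColumn K M := hN (f, M) (by simp)
    have hN' : ∀ q ∈ N, IsColumn K q.2 := fun q hq => hN q (by simp [hq])
    have hC₁ : IsClopen (C ∩ baseAtom M) := hC.inter hM.isClopen_base
    obtain ⟨D, hDL, hD, hDC⟩ := hK.transport hL.isClopen_base hC hLC hC₁ inter_subset_left
    obtain ⟨c, hcD, hcL, hcE, hc₁, hc₂⟩ :=
      hK.exists_cut hL (baseAtom_mem hL.ne_nil) hD hDL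
    obtain ⟨d, hdD, hdL, hdE, hd₁, hd₂⟩ :=
      hK.exists_cut hM (baseAtom_mem hM.ne_nil) hC₁ inter_subset_right
    have hb1 : baseAtom (L.map c) = D := by rw [baseAtom_map hL.ne_nil, hcD]
    have hb2 : baseAtom (L.map fun B => B \ c B) = baseAtom L \ D := by
      rw [baseAtom_map hL.ne_nil, hcD]
    have hb3 : baseAtom (M.map d) = C ∩ baseAtom M := by rw [baseAtom_map hM.ne_nil, hdD]
    have hb4 : baseAtom (M.map fun B => B \ d B) = baseAtom M \ (C ∩ baseAtom M) := by
      rw [baseAtom_map hM.ne_nil, hdD]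
    have hcol : IsColumn K (L.map c ++ M.map d) := hc₁.append hd₁ (by rw [hb1, hb3]; exact hDC)
    obtain ⟨W, hW, hWw, hWs⟩ := ih m (L.map fun B => B \ c B) (C \ baseAtom M) hc₂ hN'
      (hC.diff hM.isClopen_base)
      (by
        rintro x ⟨hx, hx'⟩
        have := hCN hx
        rw [baseUnion_cons] at this
        exact this.resolve_left hx')
      (by
        rw [hb2, ← sdiff_self_inter (s := C)]
        exact hLC.diff hDC hDL inter_subset_left hD hC₁)
    refine ⟨(m + f, L.map c ++ M.map d) :: (f, M.map fun B => B \ d B) :: W, ?_, ?_, ?_⟩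
    · have h1 : IsRefinement K
          ([(m + f, L.map c ++ M.map d)] ++ ([(f, M.map fun B => B \ d B)] ++ W))
          ([(m, L.map c), (f, M.map d)] ++ ([(f, M.map fun B => B \ d B)] ++
            ((m, L.map fun B => B \ c B) :: N))) :=
        (IsRefinement.stacking hcol).append ((IsRefinement.refl (by simpa using hd₂)).append hW)
      have h2 := ((IsRefinement.split (m := m) hcL hc₁ hc₂).append
        ((IsRefinement.split (m := f) hdL hd₁ hd₂).append (IsRefinement.refl hN')))
      refine (h1.perm_right ?_).trans h2
      simp only [List.cons_append, List.nil_append]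
      refine List.Perm.cons _ ?_
      exact List.perm_middle (l₁ := [(f, M.map d), (f, M.map fun B => B \ d B)]) (l₂ := N)
    · intro q hq
      simp only [List.mem_cons] at hq
      rcases hq with rfl | rfl | hq
      · exact ⟨(f, M), by simp, Or.inr rfl⟩
      · exact ⟨(f, M), by simp, Or.inl rfl⟩
      · obtain ⟨p, hp, h⟩ := hWw q hq
        exact ⟨p, by simp [hp], h⟩
    · intro μ hμ
      have h1 := hWs μ hμ
      simp only [weightSum_cons] at h1 ⊢
      rw [h1, baseAtom_append (by simp [hL.ne_nil]), hb1, hb2, hb4, real_diff μ hDL hD,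
        real_diff μ inter_subset_right hC₁, hDC.real hμ]
      push_cast
      ring

/-- Let `L` have weight `m`, the columns of `N` weights at least `-m`, and those of `P` nonnegative
weights. If the weighted sum of the masses of the bases vanishes for all measures, then the base of
`L` has at most the mass of the union of the bases of `N`, and can be copied into this union. -/
theorem IsDynamicalSimplex.exists_subset_baseUnion {m : ℤ} (hm : 0 < m) {L : List (Set X)}
    {N P : List (ℤ × List (Set X))} (hL : IsColumn K L) (hN : ∀ p ∈ N, IsColumn K p.2)
    (hP : ∀ p ∈ P, IsColumn K p.2) (hNd : ∀ x, totalMult N x ≤ 1) (hNm : ∀ p ∈ N, -m ≤ p.1)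
    (hP0 : ∀ p ∈ P, 0 ≤ p.1)
    (hs : ∀ μ ∈ K, m * (μ (baseAtom L) : ℝ) + weightSum μ N + weightSum μ P = 0) :
    ∃ C ⊆ baseUnion N, IsClopen C ∧ KEquiv K (baseAtom L) C := by
  have hm' : (0 : ℝ) < m := by exact_mod_cast hm
  have hsum : ∀ (μ : ProbabilityMeasure X) (V : List (ℤ × List (Set X))),
      weightSum μ V + m * baseSum μ V =
        (V.map fun p => ((m + p.1 : ℤ) : ℝ) * μ (baseAtom p.2)).sum := by
    intro μ V
    induction V with
    | nil => simp
    | cons p V ih =>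
      rw [List.map_cons, List.sum_cons, ← ih, weightSum_cons, baseSum_cons]
      push_cast
      ring
  by_cases h : ∀ μ ∈ K, (μ (baseAtom L) : ℝ) < μ (baseUnion N)
  · obtain ⟨C, h1, h2, h3⟩ :=
      hK.exists_subset_of_lt hL.isClopen_base (isClopen_baseUnion hN) h
    exact ⟨C, h1, h2, h3.symm⟩
  · -- Equality for one measure forces all inequalities between weights to be equalities on the
    -- nonempty columns, because these have positive mass; so equality holds for all measures.
    push Not at h
    obtain ⟨ν, hν, hle⟩ := h
    have nonneg : ∀ (g : ℤ → ℤ) (V : List (ℤ × List (Set X))), (∀ p ∈ V, 0 ≤ g p.1) →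
        ∀ t ∈ V.map fun p => ((g p.1 : ℤ) : ℝ) * ν (baseAtom p.2), 0 ≤ t := by
      intro g V hg
      simp only [List.forall_mem_map]
      exact fun p hp => mul_nonneg (by exact_mod_cast hg p hp) (NNReal.coe_nonneg _)
    have vanish : ∀ (g : ℤ → ℤ) (V : List (ℤ × List (Set X))), (∀ p ∈ V, IsColumn K p.2) →
        (∀ p ∈ V, 0 ≤ g p.1) →
        (V.map fun p => ((g p.1 : ℤ) : ℝ) * ν (baseAtom p.2)).sum = 0 → ∀ μ : ProbabilityMeasure X,
        (V.map fun p => ((g p.1 : ℤ) : ℝ) * μ (baseAtom p.2)).sum = 0 := by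
      intro g V hV hg h0 μ
      refine List.sum_eq_zero ?_
      have := fun t ht =>
        List.all_zero_of_le_zero_le_of_sum_eq_zero (nonneg g V hg) h0 (x := t) ht
      simp only [List.forall_mem_map]
      intro p hp
      rcases mul_eq_zero.1 (this _ (List.mem_map_of_mem
        (f := fun p => ((g p.1 : ℤ) : ℝ) * ν (baseAtom p.2)) hp)) with h | h
      · simp [h]
      · by_cases hne : (baseAtom p.2).Nonempty
        · exact ((hK.real_pos (hV p hp).isClopen_base hne hν).ne' h).elim
        · simp [not_nonempty_iff_eq_empty.1 hne]
    have hN0 : ∀ p ∈ N, 0 ≤ m + p.1 := fun p hp => by have := hNm p hp; omega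
    have e1 := hs ν hν
    have e2 := hsum ν N
    have e3 := List.sum_nonneg (nonneg (fun k => m + k) N hN0)
    have e4 := List.sum_nonneg (nonneg id P hP0)
    rw [real_baseUnion ν hN hNd] at hle
    have e5 := mul_le_mul_of_nonneg_left hle hm'.le
    simp only [id] at e4
    have e6 : (P.map fun p => ((id p.1 : ℤ) : ℝ) * ν (baseAtom p.2)).sum = weightSum ν P := rfl
    simp only [id] at e6
    refine ⟨baseUnion N, subset_rfl, isClopen_baseUnion hN, kEquiv_iff.2 fun μ hμ => ?_⟩
    have g1 := vanish (fun k => m + k) N hN hN0 (by linarith) μ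
    have g2 : weightSum μ P = 0 := vanish id P hP hP0 (by simp only [id]; linarith) μ
    have g3 := hs μ hμ
    have g4 := hsum μ N
    rw [real_baseUnion μ hN hNd]
    have : (m : ℝ) * (μ (baseAtom L) - baseSum μ N) = 0 := by linarith
    rcases mul_eq_zero.1 this with h | h
    · exact (hm'.ne' h).elim
    · linarith

/-- Lowering the maximal weight: the columns of maximal weight `m` are removed one by one, each
being distributed over the columns of negative weight. -/
theorem IsDynamicalSimplex.lower_max {a m : ℤ} (hm : 0 < m) (ham : a ≤ m) (k : ℕ) :
    ∀ W : List (ℤ × List (Set X)), (∀ p ∈ W, IsColumn K p.2) → (∀ x, totalMult W x ≤ 1) →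
      (∀ p ∈ W, -a ≤ p.1 ∧ p.1 ≤ m) → W.countP (fun p => p.1 = m) ≤ k →
      (∀ μ ∈ K, weightSum μ W = 0) →
      ∃ W', IsRefinement K W' W ∧ (∀ p ∈ W', -a ≤ p.1 ∧ p.1 ≤ m - 1) ∧
        ∀ μ ∈ K, weightSum μ W' = 0 := by
  induction k with
  | zero =>
    intro W hW _ hb hk hs
    refine ⟨W, .refl hW, fun p hp => ⟨(hb p hp).1, ?_⟩, hs⟩
    have h1 := (hb p hp).2
    have h2 : ¬ p.1 = m := by
      have := List.countP_eq_zero.1 (Nat.le_zero.1 hk) p hp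
      simpa using this
    omega
  | succ k ih =>
    intro W hW hd hb hk hs
    by_cases hex : ∃ p ∈ W, p.1 = m
    swap
    · push Not at hex
      refine ⟨W, .refl hW, fun p hp => ⟨(hb p hp).1, ?_⟩, hs⟩
      have h1 := (hb p hp).2
      have h2 := hex p hp
      omega
    obtain ⟨⟨m', L⟩, hp, hm'⟩ := hex
    obtain rfl : m' = m := hm'
    obtain ⟨s, t, rfl⟩ := List.append_of_mem hp
    have hperm : ((m', L) :: (s ++ t)).Perm (s ++ (m', L) :: t) := List.perm_middle.symm
    have hR : ∀ p ∈ s ++ t, p ∈ s ++ (m', L) :: t := fun p hp =>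
      hperm.subset (List.mem_cons_of_mem _ hp)
    have hL : IsColumn K L := hW _ hp
    have hRk : (s ++ t).countP (fun p => p.1 = m') ≤ k := by
      rw [← hperm.countP_eq] at hk
      simpa using hk
    have hRs : ∀ μ ∈ K, m' * (μ (baseAtom L) : ℝ) + weightSum μ (s ++ t) = 0 := by
      intro μ hμ
      have := hs μ hμ
      rwa [← weightSum_perm μ hperm, weightSum_cons] at this
    have hRd : ∀ x, mult L x + totalMult (s ++ t) x ≤ 1 := by
      intro x
      have := hd x
      rwa [← totalMult_perm hperm, totalMult_cons] at this
    set R := s ++ t with hRdef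
    by_cases hL0 : baseAtom L = ∅
    · obtain ⟨W', h1, h2, h3⟩ := ih R (fun p hp => hW p (hR p hp))
        (fun x => by have := hRd x; omega) (fun p hp => hb p (hR p hp)) hRk
        (fun μ hμ => by have := hRs μ hμ; simpa [hL0] using this)
      refine ⟨W', h1.trans (IsRefinement.perm_right (W := [(m', L)] ++ R) ?_ hperm), h2, h3⟩
      exact (IsRefinement.drop (hK.eq_empty_of_column hL (baseAtom_mem hL.ne_nil) hL0)).append
        (IsRefinement.refl fun p hp => hW p (hR p hp))
    · have hNP := List.filter_append_perm (fun p : ℤ × List (Set X) => decide (p.1 < 0)) R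
      set N := R.filter fun p => decide (p.1 < 0) with hNdef
      set P := R.filter fun p => !decide (p.1 < 0) with hPdef
      have hN : ∀ p ∈ N, p ∈ R ∧ p.1 < 0 := fun p hp => by simpa [hNdef] using hp
      have hP : ∀ p ∈ P, p ∈ R ∧ 0 ≤ p.1 := fun p hp => by simpa [hPdef] using hp
      have hNW : ∀ p ∈ N, IsColumn K p.2 := fun p hp => hW p (hR p (hN p hp).1)
      have hPW : ∀ p ∈ P, IsColumn K p.2 := fun p hp => hW p (hR p (hP p hp).1)
      have hmul : ∀ x, totalMult N x + totalMult P x = totalMult R x := fun x => by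
        rw [← totalMult_append, totalMult_perm hNP]
      have hws : ∀ μ, weightSum μ N + weightSum μ P = weightSum μ R := fun μ => by
        rw [← weightSum_append, weightSum_perm μ hNP]
      obtain ⟨C, hCN, hC, hLC⟩ := hK.exists_subset_baseUnion hm hL hNW hPW
        (fun x => by have := hRd x; have := hmul x; omega)
        (fun p hp => by have := (hb p (hR p (hN p hp).1)).1; omega)
        (fun p hp => (hP p hp).2)
        (fun μ hμ => by rw [add_assoc, hws, hRs μ hμ])
      obtain ⟨V, hV, hVw, hVs⟩ := hK.distribute N m' L C hL hNW hC hCN hLC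
      have hVP : IsRefinement K (V ++ P) (s ++ (m', L) :: t) :=
        (hV.append (IsRefinement.refl hPW)).perm_right ((hNP.cons _).trans hperm)
      have hVb : ∀ q ∈ V, -a ≤ q.1 ∧ q.1 < m' := by
        intro q hq
        obtain ⟨p, hp, h⟩ := hVw q hq
        have h1 := (hN p hp).2
        have h2 := (hb p (hR p (hN p hp).1)).1
        rcases h with h | h <;> omega
      obtain ⟨W', h1, h2, h3⟩ := ih (V ++ P) hVP.column
        (fun x => by rw [hVP.totalMult_eq]; exact hd x)
        (by
          intro p hp
          rcases List.mem_append.1 hp with hp | hp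
          · exact ⟨(hVb p hp).1, (hVb p hp).2.le⟩
          · exact hb p (hR p (hP p hp).1))
        (by
          have hV0 : V.countP (fun p => decide (p.1 = m')) = 0 :=
            List.countP_eq_zero.2 fun p hp => by simpa using (hVb p hp).2.ne
          rw [List.countP_append, hV0, zero_add]
          exact (List.filter_sublist.countP_le).trans hRk)
        (fun μ hμ => by
          have := hRs μ hμ
          rw [weightSum_append, hVs μ hμ, weightSum_cons]
          have := hws μ
          linarith)
      exact ⟨W', h1.trans hVP, h2, h3⟩

/-- A combinatorial form of Shen's criterion for dimension groups: if the weighted sum of the masses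
of the bases vanishes for all measures, then the columns can be cut and stacked into columns of
weight `0`. -/
theorem IsDynamicalSimplex.exists_balanced (n : ℕ) :
    ∀ W : List (ℤ × List (Set X)), (∀ p ∈ W, IsColumn K p.2) → (∀ x, totalMult W x ≤ 1) →
      (∀ p ∈ W, -(n : ℤ) ≤ p.1 ∧ p.1 ≤ n) → (∀ μ ∈ K, weightSum μ W = 0) →
      ∃ W', IsRefinement K W' W ∧ ∀ p ∈ W', p.1 = 0 := by
  induction n with
  | zero =>
    intro W hW _ hb _
    refine ⟨W, .refl hW, fun p hp => ?_⟩
    have := hb p hp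
    push_cast at this
    omega
  | succ n ih =>
    intro W hW hd hb hs
    obtain ⟨W₁, h1, h2, h3⟩ := hK.lower_max (a := n + 1) (m := n + 1) (by omega) le_rfl
      _ W hW hd (fun p hp => by simpa using hb p hp) le_rfl hs
    have hd₁ : ∀ x, totalMult (W₁.map fun p => (-p.1, p.2)) x ≤ 1 := fun x => by
      have : totalMult (W₁.map fun p => (-p.1, p.2)) x = totalMult W₁ x := by
        simp [totalMult, Function.comp_def]
      rw [this, h1.totalMult_eq]
      exact hd x
    obtain ⟨W₂, g1, g2, g3⟩ := hK.lower_max (a := n) (m := n + 1) (by omega) (by omega)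
      _ (W₁.map fun p => (-p.1, p.2)) (List.forall_mem_map.2 h1.column) hd₁
      (by
        simp only [List.forall_mem_map]
        intro p hp
        have := h2 p hp
        omega) le_rfl
      (fun μ hμ => by rw [weightSum_neg, h3 μ hμ, neg_zero])
    have g4 := g1.neg
    have e : (W₁.map fun p => (-p.1, p.2)).map (fun p => (-p.1, p.2)) = W₁ := by
      simp [Function.comp_def]
    rw [e] at g4
    have g5 := g4.trans h1
    obtain ⟨W₃, k1, k2⟩ := ih _ g5.column (fun x => by rw [g5.totalMult_eq]; exact hd x)
      (by
        simp only [List.forall_mem_map]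
        intro p hp
        have := g2 p hp
        omega)
      (fun μ hμ => by rw [weightSum_neg, g3 μ hμ, neg_zero])
    exact ⟨W₃, k1.trans g5, k2⟩

end Balance

/-! ### Refinements with decided atoms and with nonempty atoms -/

section Decide

variable {X : Type*}

/-- The set `A` lies in `U` or in its complement. -/
def Decided (U A : Set X) : Prop := A ⊆ U ∨ Disjoint A U

theorem Decided.mono {U A B : Set X} (h : Decided U B) (hAB : A ⊆ B) : Decided U A :=
  h.imp hAB.trans fun h => h.mono_left hAB

theorem countP_map_lt {p : Set X → Bool} {c : Set X → Set X} {L : List (Set X)}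
    (h : ∀ B ∈ L, p (c B) → p B) {A : Set X} (hA : A ∈ L) (hpA : p A) (hcA : ¬ p (c A)) :
    (L.map c).countP p < L.countP p := by
  obtain ⟨s, t, rfl⟩ := List.append_of_mem hA
  have hs : (s.map c).countP p ≤ s.countP p := by
    rw [List.countP_map]
    exact List.countP_mono_left fun B hB => h B (by simp [hB])
  have ht : (t.map c).countP p ≤ t.countP p := by
    rw [List.countP_map]
    exact List.countP_mono_left fun B hB => h B (by simp [hB])
  rw [List.map_append, List.map_cons, List.countP_append, List.countP_append, List.countP_cons,
    List.countP_cons, if_pos hpA, if_neg hcA]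
  omega

variable [MetricSpace X] [MeasurableSpace X] {K : Set (ProbabilityMeasure X)}

/-- It suffices to refine columns one at a time. -/
theorem exists_refinement_of_forall {Q : ℤ × List (Set X) → Prop}
    {W : List (ℤ × List (Set X))}
    (h : ∀ p ∈ W, ∃ W', IsRefinement K W' [p] ∧ ∀ q ∈ W', Q q) :
    ∃ W', IsRefinement K W' W ∧ ∀ q ∈ W', Q q := by
  induction W with
  | nil => exact ⟨[], .refl (by simp), by simp⟩
  | cons p W ih =>
    obtain ⟨W₁, h1, h2⟩ := h p (by simp)
    obtain ⟨W₂, h3, h4⟩ := ih fun q hq => h q (by simp [hq])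
    refine ⟨W₁ ++ W₂, h1.append h3, fun q hq => ?_⟩
    rcases List.mem_append.1 hq with hq | hq
    exacts [h2 q hq, h4 q hq]

variable [BorelSpace X] (hK : IsDynamicalSimplex K)
include hK

theorem IsDynamicalSimplex.exists_decided_column {U : Set X} (hU : IsClopen U) (m : ℤ) (k : ℕ) :
    ∀ L : List (Set X), IsColumn K L →
      (open Classical in L.countP (fun A => ¬ Decided U A) ≤ k) →
      ∃ W, IsRefinement K W [(m, L)] ∧ ∀ q ∈ W, ∀ A ∈ q.2, Decided U A := by
  classical
  induction k with
  | zero =>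
    intro L hL hk
    refine ⟨[(m, L)], .refl (by simpa using hL), ?_⟩
    simpa using List.countP_eq_zero.1 (Nat.le_zero.1 hk)
  | succ k ih =>
    intro L hL hk
    by_cases hex : ∃ A ∈ L, ¬ Decided U A
    · obtain ⟨A, hA, hAU⟩ := hex
      obtain ⟨c, hcA, hcL, -, h₁, h₂⟩ :=
        hK.exists_cut hL hA ((hL.isClopen A hA).inter hU) inter_subset_left
      have k1 : (L.map c).countP (fun A => ¬ Decided U A) < L.countP (fun A => ¬ Decided U A) := by
        refine countP_map_lt (fun B hB h => ?_) hA (by simpa using hAU) ?_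
        · simp only [decide_eq_true_eq] at h ⊢
          exact fun hd => h (hd.mono (hcL B hB))
        · simp only [hcA, decide_eq_true_eq, not_not]
          exact Or.inl inter_subset_right
      have k2 : (L.map fun B => B \ c B).countP (fun A => ¬ Decided U A) <
          L.countP (fun A => ¬ Decided U A) := by
        refine countP_map_lt (fun B hB h => ?_) hA (by simpa using hAU) ?_
        · simp only [decide_eq_true_eq] at h ⊢
          exact fun hd => h (hd.mono sdiff_subset)
        · simp only [hcA, decide_eq_true_eq, not_not, sdiff_self_inter]
          exact Or.inr disjoint_sdiff_left
      obtain ⟨W₁, a1, a2⟩ := ih _ h₁ (by omega)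
      obtain ⟨W₂, b1, b2⟩ := ih _ h₂ (by omega)
      refine ⟨W₁ ++ W₂, (a1.append b1).trans (.split hcL h₁ h₂), fun q hq => ?_⟩
      rcases List.mem_append.1 hq with hq | hq
      exacts [a2 q hq, b2 q hq]
    · push Not at hex
      exact ⟨[(m, L)], .refl (by simpa using hL), by simpa using hex⟩

theorem IsDynamicalSimplex.exists_decided {U : Set X} (hU : IsClopen U)
    {W : List (ℤ × List (Set X))} (hW : ∀ p ∈ W, IsColumn K p.2) :
    ∃ W', IsRefinement K W' W ∧ ∀ q ∈ W', ∀ A ∈ q.2, Decided U A :=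
  exists_refinement_of_forall fun p hp => hK.exists_decided_column hU p.1 _ p.2 (hW p hp) le_rfl

theorem IsDynamicalSimplex.exists_nonempty_atoms
    {W : List (ℤ × List (Set X))} (hW : ∀ p ∈ W, IsColumn K p.2) :
    ∃ W', IsRefinement K W' W ∧ ∀ q ∈ W', ∀ A ∈ q.2, A.Nonempty := by
  refine exists_refinement_of_forall fun p hp => ?_
  by_cases h : ∃ A ∈ p.2, A = ∅
  · obtain ⟨A, hA, h⟩ := h
    exact ⟨[], .drop (hK.eq_empty_of_column (hW p hp) hA h), by simp⟩
  · push Not at h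
    exact ⟨[p], .refl (by simpa using hW p hp), by simpa using h⟩

end Decide

/-! ### Making bases and tops small -/

section Shrink

variable {X : Type*} [MetricSpace X] [MeasurableSpace X] [BorelSpace X]
  {K : Set (ProbabilityMeasure X)} (hK : IsDynamicalSimplex K)
include hK

/-- If `k + 2` copies of `B` fit into the base of a column, then `k + 1` disjoint copies of `B` can
be cut off and stacked. -/
theorem IsDynamicalSimplex.exists_stacked_copies {B : Set X} (hB : IsClopen B) (k : ℕ) :
    ∀ (m : ℤ) (L : List (Set X)), IsColumn K L →
      (∀ μ ∈ K, (k + 2) * (μ B : ℝ) ≤ μ (baseAtom L)) →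
      ∃ p q : ℤ × List (Set X), IsRefinement K [p, q] [(m, L)] ∧ KEquiv K (baseAtom p.2) B ∧
        ∀ μ ∈ K, (μ (baseAtom q.2) : ℝ) = μ (baseAtom L) - (k + 1) * μ B := by
  have cut : ∀ (m : ℤ) (L : List (Set X)), IsColumn K L →
      (∀ μ ∈ K, 2 * (μ B : ℝ) ≤ μ (baseAtom L)) →
      ∃ L₁ L₂, IsColumn K L₁ ∧ IsColumn K L₂ ∧ IsRefinement K [(m, L₁), (m, L₂)] [(m, L)] ∧
        KEquiv K (baseAtom L₁) B ∧
        ∀ μ ∈ K, (μ (baseAtom L₂) : ℝ) = μ (baseAtom L) - μ B := by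
    intro m L hL h
    obtain ⟨D, hDL, hD, hDB⟩ : ∃ D ⊆ baseAtom L, IsClopen D ∧ KEquiv K D B := by
      by_cases hne : B.Nonempty
      · refine hK.exists_subset_of_lt hB hL.isClopen_base fun μ hμ => ?_
        have h1 := hK.real_pos hB hne hμ
        have h2 := h μ hμ
        linarith
      · exact ⟨∅, empty_subset _, isClopen_empty,
          fun μ _ => by rw [not_nonempty_iff_eq_empty.1 hne]⟩
    obtain ⟨c, hcD, hcL, -, h₁, h₂⟩ := hK.exists_cut hL (baseAtom_mem hL.ne_nil) hD hDL
    refine ⟨_, _, h₁, h₂, .split hcL h₁ h₂, ?_, fun μ hμ => ?_⟩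
    · rwa [baseAtom_map hL.ne_nil, hcD]
    · rw [baseAtom_map hL.ne_nil, hcD, real_diff μ hDL hD, hDB.real hμ]
  induction k with
  | zero =>
    intro m L hL h
    obtain ⟨L₁, L₂, -, -, h3, h4, h5⟩ := cut m L hL (by simpa using h)
    exact ⟨(m, L₁), (m, L₂), h3, h4, by simpa using h5⟩
  | succ k ih =>
    intro m L hL h
    obtain ⟨L₁, L₂, h1, h2, h3, h4, h5⟩ := cut m L hL (fun μ hμ => by
      have := h μ hμ
      push_cast at this
      have := mul_nonneg (Nat.cast_nonneg (α := ℝ) k) (NNReal.coe_nonneg (μ B))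
      have := NNReal.coe_nonneg (μ B)
      linarith)
    obtain ⟨p, q, g1, g2, g3⟩ := ih m L₂ h2 (fun μ hμ => by
      rw [h5 μ hμ]
      have := h μ hμ
      push_cast at this
      linarith)
    have hp := g1.column p (by simp)
    have hq := g1.column q (by simp)
    have hcol : IsColumn K (L₁ ++ p.2) := h1.append hp (h4.trans g2.symm)
    refine ⟨(m + p.1, L₁ ++ p.2), q, ?_, ?_, ?_⟩
    · refine IsRefinement.trans ?_ h3
      refine IsRefinement.trans ?_ ((IsRefinement.refl (W := [(m, L₁)]) (by simpa using h1)).append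
        g1)
      exact (IsRefinement.stacking hcol).append (.refl (W := [q]) (by simpa using hq))
    · rwa [baseAtom_append h1.ne_nil]
    · intro μ hμ
      rw [g3 μ hμ, h5 μ hμ]
      push_cast
      ring

/-- By approximate divisibility, one column can be cut and stacked so that the total mass of the
bases becomes small. -/
theorem IsDynamicalSimplex.exists_baseSum_lt_column {L : List (Set X)} (hL : IsColumn K L) (m : ℤ)
    {δ : ℝ} (hδ : 0 < δ) :
    ∃ W, IsRefinement K W [(m, L)] ∧ ∀ μ ∈ K, baseSum μ W < δ := by
  obtain ⟨k, hk⟩ := exists_nat_gt (4 / δ)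
  obtain ⟨B, hB, -, hBL⟩ := hK.approxDivisible (baseAtom L) hL.isClopen_base (k + 2) (by omega)
    (δ / 2) (by positivity)
  obtain ⟨p, q, h1, h2, h3⟩ := hK.exists_stacked_copies hB k m L hL fun μ hμ => by
    have := (hBL μ hμ).2
    push_cast at this
    exact this
  refine ⟨[p, q], h1, fun μ hμ => ?_⟩
  obtain ⟨h4, h5⟩ := hBL μ hμ
  push_cast at h4 h5
  have h6 := real_le_one μ (baseAtom L)
  have h7 : 4 < k * δ := by rwa [div_lt_iff₀ hδ] at hk
  have h8 := NNReal.coe_nonneg (μ B)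
  simp only [baseSum_cons, baseSum_nil, h2.real hμ, h3 μ hμ]
  -- The copies have mass at most `1 / (k + 2) < δ / 4`.
  have h9 : (μ B : ℝ) < δ / 4 := by
    by_contra hcon
    push Not at hcon
    have := mul_le_mul_of_nonneg_left hcon (Nat.cast_nonneg (α := ℝ) k)
    linarith
  linarith

theorem IsDynamicalSimplex.exists_baseSum_lt (W : List (ℤ × List (Set X))) :
    (∀ p ∈ W, IsColumn K p.2) → ∀ δ : ℝ, 0 < δ →
      ∃ W', IsRefinement K W' W ∧ ∀ μ ∈ K, baseSum μ W' < δ := by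
  induction W with
  | nil => exact fun _ δ hδ => ⟨[], .refl (by simp), by simpa using fun _ _ => hδ⟩
  | cons p W ih =>
    intro hW δ hδ
    obtain ⟨W₁, h1, h2⟩ := hK.exists_baseSum_lt_column (hW p (by simp)) p.1 (half_pos hδ)
    obtain ⟨W₂, h3, h4⟩ := ih (fun q hq => hW q (by simp [hq])) _ (half_pos hδ)
    refine ⟨W₁ ++ W₂, h1.append h3, fun μ hμ => ?_⟩
    have := h2 μ hμ
    have := h4 μ hμ
    rw [baseSum_append]
    linarith

/-- If the bases of the columns of `R` have total mass smaller than the common mass of the bases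
of the columns `P` and `Q`, then a piece of `P` can be put below, and a piece of `Q` on top
of each column of `R`; the rest of `Q` is put on top of the rest of `P`. -/
theorem IsDynamicalSimplex.exists_sandwich (R : List (ℤ × List (Set X))) :
    ∀ P Q : ℤ × List (Set X), IsColumn K P.2 → IsColumn K Q.2 → (∀ p ∈ R, IsColumn K p.2) →
      KEquiv K (baseAtom P.2) (baseAtom Q.2) →
      (∀ μ ∈ K, baseSum μ R < μ (baseAtom P.2)) →
      ∃ W, IsRefinement K W (P :: Q :: R) ∧
        ∀ p ∈ W, baseAtom p.2 ⊆ baseAtom P.2 ∧ topAtom p.2 ⊆ topAtom Q.2 := by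
  induction R with
  | nil =>
    rintro ⟨m, L⟩ ⟨n, M⟩ hP hQ - hPQ -
    refine ⟨[(m + n, L ++ M)], .stacking (hP.append hQ hPQ), ?_⟩
    simp [baseAtom_append hP.ne_nil, topAtom_append hQ.ne_nil]
  | cons r R ih =>
    obtain ⟨f, S⟩ := r
    rintro ⟨m, L⟩ ⟨n, M⟩ hP hQ hR hPQ hlt
    dsimp only at hP hQ hPQ hlt ⊢
    have hS : IsColumn K S := hR (f, S) (by simp)
    have hlt' : ∀ μ ∈ K, (μ (baseAtom S) : ℝ) < μ (baseAtom L) := fun μ hμ => by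
      have h1 := hlt μ hμ
      have h2 := baseSum_nonneg μ R
      rw [baseSum_cons] at h1
      linarith
    obtain ⟨D, hDL, hD, hDS⟩ := hK.exists_subset_of_lt hS.isClopen_base hP.isClopen_base hlt'
    obtain ⟨E, hEM, hE, hES⟩ := hK.exists_subset_of_lt hS.isClopen_base hQ.isClopen_base
      fun μ hμ => by rw [← hPQ.real hμ]; exact hlt' μ hμ
    obtain ⟨c, hcD, hcL, -, hc₁, hc₂⟩ := hK.exists_cut hP (baseAtom_mem hP.ne_nil) hD hDL
    obtain ⟨e, heE, heM, -, he₁, he₂⟩ := hK.exists_cut hQ (baseAtom_mem hQ.ne_nil) hE hEM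
    have hb1 : baseAtom (L.map c) = D := by rw [baseAtom_map hP.ne_nil, hcD]
    have hb2 : baseAtom (L.map fun B => B \ c B) = baseAtom L \ D := by
      rw [baseAtom_map hP.ne_nil, hcD]
    have hb3 : baseAtom (M.map e) = E := by rw [baseAtom_map hQ.ne_nil, heE]
    have hb4 : baseAtom (M.map fun B => B \ e B) = baseAtom M \ E := by
      rw [baseAtom_map hQ.ne_nil, heE]
    obtain ⟨W, hW, hW'⟩ := ih (m, L.map fun B => B \ c B) (n, M.map fun B => B \ e B) hc₂ he₂
      (fun p hp => hR p (by simp [hp]))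
      (by
        dsimp only
        rw [hb2, hb4]
        exact hPQ.diff (hDS.trans hES.symm) hDL hEM hD hE)
      (fun μ hμ => by
        dsimp only
        rw [hb2, real_diff μ hDL hD, hDS.real hμ]
        have := hlt μ hμ
        rw [baseSum_cons] at this
        linarith)
    have hLS : IsColumn K (L.map c ++ S) := hc₁.append hS (by rw [hb1]; exact hDS)
    have hcol : IsColumn K (L.map c ++ S ++ M.map e) := hLS.append he₁ (by
      rw [baseAtom_append hc₁.ne_nil, hb1, hb3]
      exact hDS.trans hES.symm)
    refine ⟨(m + f + n, L.map c ++ S ++ M.map e) :: W, ?_, ?_⟩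
    · have hR' : ∀ p ∈ R, IsColumn K p.2 := fun p hp => hR p (by simp [hp])
      have h1 : IsRefinement K [(m + f + n, L.map c ++ S ++ M.map e)]
          [(m, L.map c), (f, S), (n, M.map e)] :=
        (IsRefinement.stacking hcol).trans ((IsRefinement.stacking hLS).append
          (.refl (W := [(n, M.map e)]) (by simpa using he₁)))
      have h2 := (IsRefinement.split (m := m) hcL hc₁ hc₂).append
        ((IsRefinement.split (m := n) heM he₁ he₂).append
          (IsRefinement.refl (W := (f, S) :: R) hR))
      refine ((h1.append hW).perm_right ?_).trans h2
      simp only [List.cons_append, List.nil_append]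
      refine List.Perm.cons _ ?_
      refine (List.perm_middle (a := (f, S))
        (l₁ := [(n, M.map e), (m, L.map fun B => B \ c B), (n, M.map fun B => B \ e B)])
        (l₂ := R)).symm.trans ?_ |>.trans (List.Perm.swap _ _ _)
      exact .refl _
    · intro p hp
      rcases List.mem_cons.1 hp with rfl | hp
      · dsimp only
        rw [baseAtom_append hLS.ne_nil, baseAtom_append hc₁.ne_nil, topAtom_append he₁.ne_nil, hb1,
          topAtom_map hQ.ne_nil]
        exact ⟨hDL, heM _ (topAtom_mem hQ.ne_nil)⟩
      · obtain ⟨h1, h2⟩ := hW' p hp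
        dsimp only at h1 h2
        rw [hb2] at h1
        rw [topAtom_map hQ.ne_nil] at h2
        exact ⟨h1.trans sdiff_subset, h2.trans sdiff_subset⟩

variable [CompactSpace X] [TotallyDisconnectedSpace X] [PerfectSpace X]

/-- Columns that partition the space can be cut and stacked so that all bases lie in a set `D`, and
all tops in a set `E`, of small diameter. -/
theorem IsDynamicalSimplex.exists_small_ends {W : List (ℤ × List (Set X))}
    (hW : ∀ p ∈ W, IsColumn K p.2) (hne : ∀ x, totalMult W x = 1) [Nonempty X] {ε : ℝ}
    (hε : 0 < ε) :
    ∃ W', IsRefinement K W' W ∧ ∃ D E : Set X, Metric.diam D ≤ ε ∧ Metric.diam E ≤ ε ∧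
      ∀ p ∈ W', baseAtom p.2 ⊆ D ∧ topAtom p.2 ⊆ E := by
  -- Some column `L` has nonempty atoms.
  obtain ⟨⟨m, L⟩, hp, hL0⟩ : ∃ p ∈ W, (baseAtom p.2).Nonempty := by
    by_contra hcon
    push Not at hcon
    obtain ⟨x⟩ := ‹Nonempty X›
    have : totalMult W x = 0 := by
      refine List.sum_eq_zero ?_
      simp only [List.forall_mem_map]
      exact fun p hp => mult_eq_zero
        (hK.eq_empty_of_column (hW p hp) (baseAtom_mem (hW p hp).ne_nil) (hcon p hp)) x
    have := hne x
    omega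
  dsimp only at hL0
  have hL : IsColumn K L := hW _ hp
  obtain ⟨s, t, rfl⟩ := List.append_of_mem hp
  have hR : ∀ p ∈ s ++ t, IsColumn K p.2 := fun p hp => hW p (by
    simp only [List.mem_append, List.mem_cons] at hp ⊢
    tauto)
  have small : ∀ x : X, ∀ O : Set X, IsOpen O → x ∈ O → ∃ V ⊆ O, IsOpen V ∧ x ∈ V ∧
      ∀ V' ⊆ V, Metric.diam V' ≤ ε := by
    intro x O hO hx
    refine ⟨O ∩ Metric.ball x (ε / 2), inter_subset_left, hO.inter Metric.isOpen_ball,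
      ⟨hx, Metric.mem_ball_self (half_pos hε)⟩, fun V' hV' => ?_⟩
    refine (Metric.diam_mono (hV'.trans inter_subset_right) Metric.isBounded_ball).trans ?_
    exact (Metric.diam_ball (half_pos hε).le).trans (by linarith)
  -- It is cut into two columns with nonempty atoms.
  obtain ⟨a, ha⟩ := hL0
  obtain ⟨b, hb, hab⟩ : ∃ b ∈ baseAtom L, b ≠ a := by
    have := PerfectSpace.univ_preperfect (α := X)
    have := (this.open_inter hL.isClopen_base.isOpen) a ⟨ha, mem_univ a⟩
    rw [accPt_iff_nhds] at this
    obtain ⟨b, hb, hab⟩ := this univ univ_mem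
    exact ⟨b, hb.2.1, hab⟩
  obtain ⟨F, hF, haF, hFb⟩ := compact_exists_isClopen_in_isOpen
    (hL.isClopen_base.isOpen.inter (isOpen_compl_singleton (x := b))) ⟨ha, hab.symm⟩
  obtain ⟨c, hcF, hcL, -, hc₁, hc₂⟩ := hK.exists_cut hL (baseAtom_mem hL.ne_nil) hF
    (hFb.trans inter_subset_left)
  set L₁ := L.map c with hL₁
  set L₂ := L.map fun B => B \ c B with hL₂
  have hb1 : baseAtom L₁ = F := by rw [hL₁, baseAtom_map hL.ne_nil, hcF]
  have hb2 : b ∈ baseAtom L₂ := by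
    rw [hL₂, baseAtom_map hL.ne_nil, hcF]
    exact ⟨hb, fun h => (hFb h).2 rfl⟩
  -- A small clopen set `E₀` in the top of the second one, a smaller one `D` in the base of the
  -- first one, and a copy `E` of `D` in `E₀`.
  obtain ⟨e, he⟩ : (topAtom L₂).Nonempty := by
    by_contra h
    have := hK.eq_empty_of_column hc₂ (topAtom_mem hc₂.ne_nil) (not_nonempty_iff_eq_empty.1 h) _
      (baseAtom_mem hc₂.ne_nil)
    rw [this] at hb2
    exact hb2
  have hT := hc₂.isClopen _ (topAtom_mem hc₂.ne_nil)
  obtain ⟨V, hVT, hV, heV, hVd⟩ := small e _ hT.isOpen he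
  obtain ⟨E₀, hE₀, heE₀, hE₀V⟩ := compact_exists_isClopen_in_isOpen hV heV
  obtain ⟨V', hV'F, hV', haV', hV'd⟩ := small a F hF.isOpen haF
  obtain ⟨D, hDV', hD, haD, hDlt⟩ := hK.exists_small hE₀ ⟨e, heE₀⟩ hV' haV'
  obtain ⟨E, hEE₀, hE, hED⟩ := hK.exists_subset_of_lt hD hE₀ hDlt
  obtain ⟨c', hcD, hcL', -, hc₁', hc₂'⟩ := hK.exists_cut hc₁ (baseAtom_mem hc₁.ne_nil) hD
    (by rw [hb1]; exact hDV'.trans hV'F)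
  obtain ⟨d, hdE, hdL, hdeq, hd₁, hd₂⟩ := hK.exists_cut hc₂ (topAtom_mem hc₂.ne_nil) hE
    (hEE₀.trans (hE₀V.trans hVT))
  have hbD : baseAtom (L₁.map c') = D := by rw [baseAtom_map hc₁.ne_nil, hcD]
  have htE : topAtom (L₂.map d) = E := by rw [topAtom_map hc₂.ne_nil, hdE]
  have hbE : KEquiv K (baseAtom (L₂.map d)) D := by
    rw [baseAtom_map hc₂.ne_nil]
    exact (hdeq _ (baseAtom_mem hc₂.ne_nil)).trans hED
  obtain ⟨δ, hδ, hδD⟩ := hK.exists_pos_le hD ⟨a, haD⟩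
  have hR₀ : ∀ p ∈ (m, L₁.map fun B => B \ c' B) :: (m, L₂.map fun B => B \ d B) :: (s ++ t),
      IsColumn K p.2 := by
    intro p hp
    simp only [List.mem_cons] at hp
    rcases hp with rfl | rfl | hp
    exacts [hc₂', hd₂, hR p hp]
  obtain ⟨R', hR', hR's⟩ := hK.exists_baseSum_lt _ hR₀ δ hδ
  obtain ⟨W', hW', hW'e⟩ := hK.exists_sandwich R' (m, L₁.map c') (m, L₂.map d) hc₁' hd₁ hR'.column
    (by dsimp only; rw [hbD]; exact hbE.symm)
    (fun μ hμ => by dsimp only; rw [hbD]; exact (hR's μ hμ).trans_le (hδD μ hμ))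
  refine ⟨W', ?_, D, E, hV'd _ hDV', hVd _ (hEE₀.trans hE₀V), fun p hp => ?_⟩
  · have h1 : IsRefinement K ((m, L₁.map c') :: (m, L₂.map d) :: R') _ :=
      (IsRefinement.refl (W := [(m, L₁.map c'), (m, L₂.map d)])
        (by simp [hc₁', hd₁])).append hR'
    have h2 := ((IsRefinement.split (m := m) hcL' hc₁' hc₂').append
      (IsRefinement.split (m := m) hdL hd₁ hd₂)).trans (.split hcL hc₁ hc₂)
    have h3 := (h2.append (.refl hR)).perm_right (V := s ++ (m, L) :: t)
      (List.perm_middle (l₁ := s) (l₂ := t)).symm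
    refine hW'.trans ((h1.perm_right ?_).trans h3)
    simp only [List.cons_append, List.nil_append]
    exact .cons _ (.swap _ _ _)
  · have := hW'e p hp
    dsimp only at this
    rwa [hbD, htE] at this

end Shrink

/-! ### One step of the construction -/

section Count

variable {X : Type*}

open Classical in
/-- The number of atoms of the column `L` that lie in `U`. -/
noncomputable def countIn (U : Set X) (L : List (Set X)) : ℕ := L.countP fun A => A ⊆ U

theorem countIn_append (U : Set X) (L L' : List (Set X)) :
    countIn U (L ++ L') = countIn U L + countIn U L' := by
  simp [countIn]

open Classical in
theorem countIn_cons (U A : Set X) (L : List (Set X)) :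
    countIn U (A :: L) = countIn U L + if A ⊆ U then 1 else 0 := by
  simp [countIn, List.countP_cons]

theorem countIn_eq_of_forall₂ {U : Set X} {L N : List (Set X)}
    (h : List.Forall₂ (fun A B => A ⊆ B) L N) (hL : ∀ A ∈ L, A.Nonempty)
    (hN : ∀ B ∈ N, Decided U B) : countIn U L = countIn U N := by
  induction h with
  | nil => rfl
  | @cons A B L N hAB _ ih =>
    have h1 := ih (fun A hA => hL A (by simp [hA])) (fun B hB => hN B (by simp [hB]))
    have h2 : A ⊆ U ↔ B ⊆ U := by
      refine ⟨fun h => ?_, hAB.trans⟩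
      rcases hN B (by simp) with h' | h'
      · exact h'
      · obtain ⟨x, hx⟩ := hL A (by simp)
        exact (Set.disjoint_left.1 h' (hAB hx) (h hx)).elim
    rw [countIn_cons, countIn_cons, h1]
    by_cases h : B ⊆ U
    · rw [if_pos h, if_pos (h2.2 h)]
    · rw [if_neg h, if_neg (mt h2.1 h)]

/-- The list `W` with the weight of each column replaced by the difference of the numbers of its
atoms in `U` and in `V`. -/
noncomputable def relabel (U V : Set X) (W : List (ℤ × List (Set X))) :
    List (ℤ × List (Set X)) :=
  W.map fun p => ((countIn U p.2 : ℤ) - countIn V p.2, p.2)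

theorem Stack.eq_countIn {U V : Set X} {W : List (ℤ × List (Set X))}
    (hU : ∀ p ∈ W, ∀ A ∈ p.2, Decided U A) (hV : ∀ p ∈ W, ∀ A ∈ p.2, Decided V A) {m : ℤ}
    {L : List (Set X)} (h : Stack (relabel U V W) m L) (hL : ∀ A ∈ L, A.Nonempty) :
    m = (countIn U L : ℤ) - countIn V L := by
  induction h with
  | block hN h =>
    obtain ⟨p, hp, hpe⟩ := List.mem_map.1 hN
    simp only [Prod.mk.injEq] at hpe
    obtain ⟨rfl, rfl⟩ := hpe
    rw [countIn_eq_of_forall₂ h hL (hU p hp), countIn_eq_of_forall₂ h hL (hV p hp)]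
  | append _ _ ih₁ ih₂ =>
    rw [ih₁ fun A hA => hL A (by simp [hA]), ih₂ fun A hA => hL A (by simp [hA]), countIn_append,
      countIn_append]
    push_cast
    ring

theorem Stack.weight_eq_zero {W : List (ℤ × List (Set X))} (hW : ∀ p ∈ W, p.1 = 0) {m : ℤ}
    {L : List (Set X)} (h : Stack W m L) : m = 0 := by
  induction h with
  | block hN _ => exact hW _ hN
  | append _ _ ih₁ ih₂ => rw [ih₁, ih₂, add_zero]

theorem Stack.of_relabel {U V : Set X} {W : List (ℤ × List (Set X))} {m : ℤ} {L : List (Set X)}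
    (h : Stack (relabel U V W) m L) : ∃ m', Stack W m' L := by
  refine h.trans' fun p hp => ?_
  obtain ⟨q, hq, rfl⟩ := List.mem_map.1 hp
  exact ⟨q.1, .of_mem hq⟩

theorem totalMult_relabel (U V : Set X) (W : List (ℤ × List (Set X))) (x : X) :
    totalMult (relabel U V W) x = totalMult W x := by
  simp [totalMult, relabel, Function.comp_def]

theorem totalMult_eq_mult_flatMap (W : List (ℤ × List (Set X))) (x : X) :
    totalMult W x = mult (W.flatMap Prod.snd) x := by
  induction W with
  | nil => rfl
  | cons p W ih => simp [ih]

theorem exists_weight_bound (W : List (ℤ × List (Set X))) :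
    ∃ n : ℕ, ∀ p ∈ W, -(n : ℤ) ≤ p.1 ∧ p.1 ≤ n := by
  induction W with
  | nil => exact ⟨0, by simp⟩
  | cons p W ih =>
    obtain ⟨n, hn⟩ := ih
    refine ⟨n + p.1.natAbs, fun q hq => ?_⟩
    rcases List.mem_cons.1 hq with rfl | hq
    · omega
    · have := hn q hq
      omega

variable [MeasurableSpace X]

theorem weightSum_relabel {μ : ProbabilityMeasure X} (U V : Set X) (W : List (ℤ × List (Set X))) :
    weightSum μ (relabel U V W) =
      (W.map fun p => (countIn U p.2 : ℝ) * μ (baseAtom p.2)).sum -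
        (W.map fun p => (countIn V p.2 : ℝ) * μ (baseAtom p.2)).sum := by
  induction W with
  | nil => simp [relabel]
  | cons p W ih =>
    have : relabel U V (p :: W) =
      ((countIn U p.2 : ℤ) - countIn V p.2, p.2) :: relabel U V W := rfl
    rw [this, weightSum_cons, ih]
    simp only [List.map_cons, List.sum_cons]
    push_cast
    ring

variable [MetricSpace X] [BorelSpace X] {K : Set (ProbabilityMeasure X)}

open Classical in
/-- The part of `U` covered by disjoint nonempty atoms that decide `U` is the union of the atoms
inside `U`. -/
theorem real_inter_atoms (μ : ProbabilityMeasure X) {U : Set X} (L : List (Set X))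
    (hL : ∀ A ∈ L, IsClopen A) (hd : ∀ x, mult L x ≤ 1) (hUL : ∀ A ∈ L, Decided U A)
    (hU : IsClopen U) (hne : ∀ A ∈ L, A.Nonempty) :
    IsClopen {x | x ∈ U ∧ ∃ A ∈ L, x ∈ A} ∧
    (μ {x | x ∈ U ∧ ∃ A ∈ L, x ∈ A} : ℝ) =
      (L.map fun A => if A ⊆ U then (μ A : ℝ) else 0).sum := by
  induction L with
  | nil => simp [isClopen_empty]
  | cons A L ih =>
    obtain ⟨h1, h2⟩ := ih (fun B hB => hL B (by simp [hB]))
      (fun x => by have := hd x; rw [mult_cons] at this; omega)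
      (fun B hB => hUL B (by simp [hB])) (fun B hB => hne B (by simp [hB]))
    have e : {x | x ∈ U ∧ ∃ B ∈ A :: L, x ∈ B} = (A ∩ U) ∪ {x | x ∈ U ∧ ∃ B ∈ L, x ∈ B} := by
      ext x
      simp only [List.mem_cons, exists_eq_or_imp, mem_ofPred_eq, mem_union, mem_inter_iff]
      tauto
    rw [e]
    refine ⟨((hL A (by simp)).inter hU).union h1, ?_⟩
    rw [real_union μ _ h1, h2, List.map_cons, List.sum_cons]
    · congr 1
      split_ifs with h
      · rw [inter_eq_left.2 h]
      · have := ((hUL A (by simp)).resolve_left h).inter_eq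
        rw [this, real_empty]
    · rw [Set.disjoint_left]
      rintro x ⟨hx, -⟩ ⟨-, B, hB, hxB⟩
      have h3 := hd x
      have h4 := one_le_mult hB hxB
      rw [mult_cons, indicator_of_mem hx] at h3
      omega

/-- If the atoms decide `U`, each column `L` contributes `countIn U L` times the mass of its base to
the mass of `U`. -/
theorem real_eq_weightSum {μ : ProbabilityMeasure X} (hμ : μ ∈ K) {U : Set X}
    {W : List (ℤ × List (Set X))} (hW : ∀ p ∈ W, IsColumn K p.2) (hd : ∀ x, totalMult W x = 1)
    (hU : IsClopen U) (hUW : ∀ p ∈ W, ∀ A ∈ p.2, Decided U A)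
    (hne : ∀ p ∈ W, ∀ A ∈ p.2, A.Nonempty) :
    (μ U : ℝ) = (W.map fun p => (countIn U p.2 : ℝ) * μ (baseAtom p.2)).sum := by
  classical
  have h := (real_inter_atoms μ (U := U) (W.flatMap Prod.snd)
    (fun A hA => by obtain ⟨p, hp, hA⟩ := List.mem_flatMap.1 hA; exact (hW p hp).isClopen A hA)
    (fun x => by rw [← totalMult_eq_mult_flatMap, hd])
    (fun A hA => by obtain ⟨p, hp, hA⟩ := List.mem_flatMap.1 hA; exact hUW p hp A hA) hU
    (fun A hA => by obtain ⟨p, hp, hA⟩ := List.mem_flatMap.1 hA; exact hne p hp A hA)).2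
  have e : {x | x ∈ U ∧ ∃ A ∈ W.flatMap Prod.snd, x ∈ A} = U := by
    ext x
    refine ⟨fun h => h.1, fun h => ⟨h, ?_⟩⟩
    by_contra hcon
    push Not at hcon
    have h0 : mult (W.flatMap Prod.snd) x = 0 := by
      refine List.sum_eq_zero ?_
      simp only [List.forall_mem_map]
      exact fun A hA => indicator_of_notMem (hcon A hA) _
    have := hd x
    rw [totalMult_eq_mult_flatMap] at this
    omega
  rw [e] at h
  rw [h]
  clear h e hd
  induction W with
  | nil => rfl
  | cons p W ih =>
    rw [List.flatMap_cons, List.map_append, List.sum_append, List.map_cons, List.sum_cons,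
      ih (fun q hq => hW q (by simp [hq])) (fun q hq => hUW q (by simp [hq]))
        (fun q hq => hne q (by simp [hq]))]
    congr 1
    have key : ∀ L : List (Set X), (∀ A ∈ L, (μ A : ℝ) = μ (baseAtom p.2)) →
        (L.map fun A => if A ⊆ U then (μ A : ℝ) else 0).sum = countIn U L * μ (baseAtom p.2) := by
      intro L hL
      induction L with
      | nil => simp [countIn]
      | cons A L ih =>
        rw [List.map_cons, List.sum_cons, ih fun B hB => hL B (by simp [hB]), countIn_cons,
          hL A (by simp)]
        split_ifs <;> push_cast <;> ring
    exact key _ fun A hA => ((hW p (by simp)).equiv_base hA).real hμ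

/-- `W` is a list of columns with nonempty atoms that partition the space. -/
structure IsKRList (K : Set (ProbabilityMeasure X)) (W : List (ℤ × List (Set X))) : Prop where
  column : ∀ p ∈ W, IsColumn K p.2
  totalMult_eq : ∀ x, totalMult W x = 1
  nonempty : ∀ p ∈ W, ∀ A ∈ p.2, A.Nonempty

/-- Given clopen sets `U` and `V`, every partition into columns has a refinement with atoms that
decide `U` and `V`, with small bases and tops, and such that, if `U` and `V` are equivalent, every
column has as many atoms in `U` as in `V`. -/
theorem IsDynamicalSimplex.exists_step (hK : IsDynamicalSimplex K) [CompactSpace X]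
    [TotallyDisconnectedSpace X] [PerfectSpace X] [Nonempty X]
    {W : List (ℤ × List (Set X))} (hW : IsKRList K W) {U V : Set X} (hU : IsClopen U)
    (hV : IsClopen V) {ε : ℝ} (hε : 0 < ε) :
    ∃ W', IsKRList K W' ∧ (∀ p ∈ W', ∃ m, Stack W m p.2) ∧
      (∃ D E : Set X, Metric.diam D ≤ ε ∧ Metric.diam E ≤ ε ∧
        ∀ p ∈ W', baseAtom p.2 ⊆ D ∧ topAtom p.2 ⊆ E) ∧
      (∀ p ∈ W', ∀ A ∈ p.2, Decided U A ∧ Decided V A) ∧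
      (KEquiv K U V → ∀ p ∈ W', countIn U p.2 = countIn V p.2) := by
  obtain ⟨W₁, r1, d1⟩ := hK.exists_decided hU hW.column
  obtain ⟨W₂, r2, d2⟩ := hK.exists_decided hV r1.column
  obtain ⟨W₃, r3, d3⟩ := hK.exists_nonempty_atoms r2.column
  have dV : ∀ p ∈ W₃, ∀ A ∈ p.2, Decided V A := fun p hp A hA => by
    obtain ⟨q, hq, B, hB, hAB⟩ := (r3.stack p hp).exists_superset A hA
    exact (d2 q hq B hB).mono hAB
  have dU : ∀ p ∈ W₃, ∀ A ∈ p.2, Decided U A := fun p hp A hA => by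
    obtain ⟨q, hq, B, hB, hAB⟩ := ((r3.trans r2).stack p hp).exists_superset A hA
    exact (d1 q hq B hB).mono hAB
  have r : IsRefinement K W₃ W := r3.trans (r2.trans r1)
  have m3 : ∀ x, totalMult W₃ x = 1 := fun x => by rw [r.totalMult_eq, hW.totalMult_eq]
  have c4 : ∀ p ∈ relabel U V W₃, IsColumn K p.2 := List.forall_mem_map.2 r3.column
  obtain ⟨W₄, r4, z4⟩ : ∃ W₄, IsRefinement K W₄ (relabel U V W₃) ∧
      (KEquiv K U V → ∀ p ∈ W₄, p.1 = 0) := by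
    by_cases hUV : KEquiv K U V
    · obtain ⟨n, hn⟩ := exists_weight_bound (relabel U V W₃)
      obtain ⟨W₄, h1, h2⟩ := hK.exists_balanced n (relabel U V W₃) c4
        (fun x => by rw [totalMult_relabel, m3]) hn (fun μ hμ => by
          rw [weightSum_relabel, ← real_eq_weightSum hμ r3.column m3 hU dU d3,
            ← real_eq_weightSum hμ r3.column m3 hV dV d3, hUV.real hμ, sub_self])
      exact ⟨W₄, h1, fun _ => h2⟩
    · exact ⟨_, .refl c4, fun h => (hUV h).elim⟩
  have m4 : ∀ x, totalMult W₄ x = 1 := fun x => by rw [r4.totalMult_eq, totalMult_relabel, m3]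
  obtain ⟨W₅, r5, D, E, hD, hE, hDE⟩ := hK.exists_small_ends r4.column m4 hε
  obtain ⟨W₆, r6, d6⟩ := hK.exists_nonempty_atoms r5.column
  have r' := r6.trans (r5.trans r4)
  have loose : ∀ p ∈ W₆, ∃ m, Stack W₃ m p.2 := fun p hp => (r'.stack p hp).of_relabel
  refine ⟨W₆, ⟨r6.column, fun x => by rw [r6.totalMult_eq, r5.totalMult_eq, m4], d6⟩, ?_,
    ⟨D, E, hD, hE, ?_⟩, ?_, ?_⟩
  · intro p hp
    obtain ⟨m, hm⟩ := loose p hp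
    exact ⟨m, hm.trans r.stack⟩
  · intro p hp
    obtain ⟨q, hq, h1⟩ := (r6.stack p hp).baseAtom_subset fun q hq => (r5.column q hq).ne_nil
    obtain ⟨q', hq', h2⟩ := (r6.stack p hp).topAtom_subset fun q hq => (r5.column q hq).ne_nil
    exact ⟨h1.trans (hDE q hq).1, h2.trans (hDE q' hq').2⟩
  · intro p hp A hA
    obtain ⟨m, hm⟩ := loose p hp
    obtain ⟨q, hq, B, hB, hAB⟩ := hm.exists_superset A hA
    exact ⟨(dU q hq B hB).mono hAB, (dV q hq B hB).mono hAB⟩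
  · intro hUV p hp
    have h0 := ((r6.trans r5).stack p hp).weight_eq_zero (z4 hUV)
    have h1 := (r'.stack p hp).eq_countIn dU dV (d6 p hp)
    omega

end Count

/-! ### From lists of columns to Kakutani–Rokhlin partitions -/

section ToKR

variable {X : Type*}

theorem two_le_sum_map {α : Type*} (l : List α) (f : α → ℕ) {i j : ℕ} (hi : i < l.length)
    (hj : j < l.length) (hij : i ≠ j) (h1 : 1 ≤ f l[i]) (h2 : 1 ≤ f l[j]) :
    2 ≤ (l.map f).sum := by
  rw [← Fin.sum_univ_fun_getElem]
  have hne : (⟨i, hi⟩ : Fin l.length) ≠ ⟨j, hj⟩ := by simpa using hij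
  have := Finset.sum_le_sum_of_subset (f := fun i : Fin l.length => f l[i.1])
    (Finset.subset_univ {⟨i, hi⟩, ⟨j, hj⟩})
  rw [Finset.sum_pair hne] at this
  dsimp only at this
  omega

theorem forall₂_getD {L N : List (Set X)} (h : List.Forall₂ (fun A B => A ⊆ B) L N) (j : ℕ) :
    L.getD j ∅ ⊆ N.getD j ∅ := by
  induction h generalizing j with
  | nil => exact subset_rfl
  | cons hab _ ih =>
    cases j with
    | zero => simpa using hab
    | succ j => simpa using ih j

open Classical in
theorem countIn_eq_card (U : Set X) (L : List (Set X)) :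
    countIn U L = ((Finset.range L.length).filter fun r => L.getD r ∅ ⊆ U).card := by
  induction L with
  | nil => rfl
  | cons A L ih =>
    rw [countIn_cons, ih, Finset.card_filter, Finset.card_filter, List.length_cons,
      Finset.sum_range_succ']
    simp

/-- The description of stacked columns by an index function, as in the definition of refinements
of Kakutani–Rokhlin partitions. -/
theorem Stack.exists_index {ι : Type*} {col : ι → List (Set X)} (hcol : ∀ i, col i ≠ [])
    {W : List (ℤ × List (Set X))} (hW : ∀ p ∈ W, ∃ i, col i = p.2) {w : ℤ} {L : List (Set X)}
    (h : Stack W w L) :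
    ∃ (m : ℕ) (c : ℕ → ι),
      L.length = ∑ k ∈ Finset.range (m + 1), (((col (c k)).length - 1) + 1) ∧
      ∀ k ≤ m, ∀ j ≤ (col (c k)).length - 1,
        L.getD (j + ∑ l ∈ Finset.range k, (((col (c l)).length - 1) + 1)) ∅ ⊆
          (col (c k)).getD j ∅ := by
  set f : ι → ℕ := fun i => ((col i).length - 1) + 1 with hf
  induction h with
  | @block w L N hN h =>
    obtain ⟨i, rfl⟩ := hW _ hN
    refine ⟨0, fun _ => i, ?_, ?_⟩
    · have := List.length_pos_iff.2 (hcol i)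
      simp only [zero_add, Finset.range_one, Finset.sum_singleton]
      rw [h.length_eq]
      omega
    · intro k hk j _
      obtain rfl : k = 0 := by omega
      simpa using forall₂_getD h j
  | @append _ _ L₁ L₂ h₁ h₂ ih₁ ih₂ =>
    obtain ⟨m₁, c₁, e₁, s₁⟩ := ih₁
    obtain ⟨m₂, c₂, e₂, s₂⟩ := ih₂
    set c : ℕ → ι := fun k => if k ≤ m₁ then c₁ k else c₂ (k - (m₁ + 1)) with hc
    have hc1 : ∀ k ≤ m₁, c k = c₁ k := fun k hk => if_pos hk
    have hc2 : ∀ k, c (m₁ + 1 + k) = c₂ k := fun k => by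
      rw [hc]
      dsimp only
      rw [if_neg (by omega), Nat.add_sub_cancel_left]
    have g1 : ∀ n ≤ m₁ + 1, ∑ k ∈ Finset.range n, f (c k) = ∑ k ∈ Finset.range n, f (c₁ k) :=
      fun n hn => Finset.sum_congr rfl fun k hk => by
        rw [hc1 k (by have := Finset.mem_range.1 hk; omega)]
    have g2 : ∀ n, ∑ k ∈ Finset.range (m₁ + 1 + n), f (c k) =
        L₁.length + ∑ k ∈ Finset.range n, f (c₂ k) := fun n => by
      rw [Finset.sum_range_add, g1 _ le_rfl, e₁]
      simp only [hc2, hf]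
    refine ⟨m₁ + 1 + m₂, c, ?_, ?_⟩
    · rw [List.length_append, e₂]
      exact (g2 (m₂ + 1)).symm
    · intro k hk j hj
      by_cases hk1 : k ≤ m₁
      · rw [hc1 k hk1] at hj
        have hlt : j + ∑ l ∈ Finset.range k, f (c₁ l) < L₁.length := by
          have h3 : ∑ l ∈ Finset.range (k + 1), f (c₁ l) ≤ ∑ l ∈ Finset.range (m₁ + 1), f (c₁ l) :=
            Finset.sum_le_sum_of_subset (Finset.range_subset_range.2 (by omega))
          rw [Finset.sum_range_succ] at h3
          have h4 : f (c₁ k) = ((col (c₁ k)).length - 1) + 1 := rfl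
          have h5 : L₁.length = ∑ l ∈ Finset.range (m₁ + 1), f (c₁ l) := e₁
          omega
        have h6 := s₁ k hk1 j hj
        have h7 := g1 k (by omega)
        simp only [hf] at h7 hlt
        rw [h7, List.getD_append _ _ _ _ hlt, hc1 k hk1]
        exact h6
      · obtain ⟨k', rfl⟩ := Nat.exists_eq_add_of_le (show m₁ + 1 ≤ k by omega)
        rw [hc2] at hj
        have h6 := s₂ k' (by omega) j hj
        have h7 := g2 k'
        simp only [hf] at h7
        rw [h7, List.getD_append_right _ _ _ _ (by omega), hc2]
        convert h6 using 2
        omega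

variable [MetricSpace X] [MeasurableSpace X] {K : Set (ProbabilityMeasure X)}

theorem IsKRList.getD_eq {W : List (ℤ × List (Set X))} (hW : IsKRList K W) (i : Fin W.length)
    {r : ℕ} (hr : r ≤ W[i.1].2.length - 1) :
    ∃ h : r < W[i.1].2.length, W[i.1].2.getD r ∅ = W[i.1].2[r] := by
  have := List.length_pos_iff.2 (hW.column _ (List.getElem_mem i.2)).ne_nil
  exact ⟨by omega, List.getD_eq_getElem _ _ (by omega)⟩

theorem IsKRList.getD_mem {W : List (ℤ × List (Set X))} (hW : IsKRList K W) (i : Fin W.length)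
    {r : ℕ} (hr : r ≤ W[i.1].2.length - 1) : W[i.1].2.getD r ∅ ∈ W[i.1].2 := by
  obtain ⟨h, e⟩ := hW.getD_eq i hr
  rw [e]
  exact List.getElem_mem h

/-- The Kakutani–Rokhlin partition given by a list of columns. -/
noncomputable def IsKRList.toKRPartition {W : List (ℤ × List (Set X))} (hW : IsKRList K W) :
    KRPartition K where
  Column := Fin W.length
  finite := inferInstance
  height i := W[i.1].2.length - 1
  atom i r := W[i.1].2.getD r ∅
  isClopen i _ hr := (hW.column _ (List.getElem_mem i.2)).isClopen _ (hW.getD_mem i hr)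
  nonempty i _ hr := hW.nonempty _ (List.getElem_mem i.2) _ (hW.getD_mem i hr)
  disjoint := by
    intro i r hr j s hs hne
    rw [Set.disjoint_left]
    intro x hxi hxj
    have hx := hW.totalMult_eq x
    have hi := one_le_mult (hW.getD_mem i hr) hxi
    have hj := one_le_mult (hW.getD_mem j hs) hxj
    by_cases hij : i = j
    · subst hij
      have hrs : r ≠ s := hne.resolve_left fun h => h rfl
      obtain ⟨hr', er⟩ := hW.getD_eq i hr
      obtain ⟨hs', es⟩ := hW.getD_eq i hs
      rw [er] at hxi
      rw [es] at hxj
      have h2 := two_le_sum_map W[i.1].2 (fun A => A.indicator (fun _ => 1) x) hr' hs' hrs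
        (by rw [indicator_of_mem hxi]) (by rw [indicator_of_mem hxj])
      have h3 := List.single_le_sum (l := W.map fun p => mult p.2 x) (fun _ _ => Nat.zero_le _) _
        (List.mem_map_of_mem (f := fun p => mult p.2 x) (List.getElem_mem i.2))
      have h4 : (W.map fun p => mult p.2 x).sum = totalMult W x := rfl
      have h5 : mult W[i.1].2 x = (W[i.1].2.map fun A => A.indicator (fun _ => 1) x).sum := rfl
      omega
    · have h2 := two_le_sum_map W (fun p => mult p.2 x) i.2 j.2 (fun h => hij (Fin.ext h)) hi hj
      have h4 : (W.map fun p => mult p.2 x).sum = totalMult W x := rfl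
      omega
  cover := by
    intro x
    by_contra hcon
    push Not at hcon
    have h0 : totalMult W x = 0 := by
      refine List.sum_eq_zero ?_
      simp only [List.forall_mem_map]
      intro p hp
      obtain ⟨i, hi, rfl⟩ := List.getElem_of_mem hp
      refine List.sum_eq_zero ?_
      simp only [List.forall_mem_map]
      intro A hA
      obtain ⟨r, hr, rfl⟩ := List.getElem_of_mem hA
      refine indicator_of_notMem ?_ _
      have := hcon ⟨i, hi⟩ r (by dsimp only; omega)
      rwa [List.getD_eq_getElem _ _ hr] at this
    have := hW.totalMult_eq x
    omega
  equiv i _ hr _ hs := (hW.column _ (List.getElem_mem i.2)).equiv _ (hW.getD_mem i hr) _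
    (hW.getD_mem i hs)

theorem IsKRList.base_toKRPartition {W : List (ℤ × List (Set X))} (hW : IsKRList K W) (x : X) :
    x ∈ hW.toKRPartition.base ↔ ∃ p ∈ W, x ∈ baseAtom p.2 := by
  have e : ∀ L : List (Set X), L.getD 0 ∅ = baseAtom L := fun L => by cases L <;> rfl
  simp only [KRPartition.base, mem_iUnion]
  constructor
  · rintro ⟨i, hi⟩
    exact ⟨_, List.getElem_mem i.2, by rw [← e]; exact hi⟩
  · rintro ⟨p, hp, hx⟩
    obtain ⟨i, hi, rfl⟩ := List.getElem_of_mem hp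
    exact ⟨⟨i, hi⟩, by rw [← e] at hx; exact hx⟩

theorem IsKRList.top_toKRPartition {W : List (ℤ × List (Set X))} (hW : IsKRList K W) (x : X) :
    x ∈ hW.toKRPartition.top ↔ ∃ p ∈ W, x ∈ topAtom p.2 := by
  have e : ∀ L : List (Set X), L.getD (L.length - 1) ∅ = topAtom L := fun L => by
    by_cases h : L = []
    · subst h; rfl
    · have := List.length_pos_iff.2 h
      rw [topAtom_eq_getLast h, List.getLast_eq_getElem, List.getD_eq_getElem]
  simp only [KRPartition.top, mem_iUnion]
  constructor
  · rintro ⟨i, hi⟩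
    exact ⟨_, List.getElem_mem i.2, by rw [← e]; exact hi⟩
  · rintro ⟨p, hp, hx⟩
    obtain ⟨i, hi, rfl⟩ := List.getElem_of_mem hp
    exact ⟨⟨i, hi⟩, by rw [← e] at hx; exact hx⟩

theorem IsKRList.refines {W W' : List (ℤ × List (Set X))} (hW : IsKRList K W)
    (hW' : IsKRList K W') (h : ∀ p ∈ W', ∃ m, Stack W m p.2) :
    hW'.toKRPartition.Refines hW.toKRPartition := by
  have hne : ∀ p ∈ W, p.2 ≠ [] := fun p hp => (hW.column p hp).ne_nil
  refine ⟨fun x => ?_, fun x => ?_, fun i => ?_⟩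
  · rw [hW'.base_toKRPartition, hW.base_toKRPartition]
    rintro ⟨p, hp, hx⟩
    obtain ⟨m, hm⟩ := h p hp
    obtain ⟨q, hq, hs⟩ := hm.baseAtom_subset hne
    exact ⟨q, hq, hs hx⟩
  · rw [hW'.top_toKRPartition, hW.top_toKRPartition]
    rintro ⟨p, hp, hx⟩
    obtain ⟨m, hm⟩ := h p hp
    obtain ⟨q, hq, hs⟩ := hm.topAtom_subset hne
    exact ⟨q, hq, hs hx⟩
  · change Fin W'.length at i
    obtain ⟨m, hm⟩ := h _ (List.getElem_mem i.2)
    obtain ⟨n, c, h1, h2⟩ := hm.exists_index (col := fun i : Fin W.length => W[i.1].2)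
      (fun i => hne _ (List.getElem_mem i.2)) fun p hp => by
        obtain ⟨i, hi, rfl⟩ := List.getElem_of_mem hp
        exact ⟨⟨i, hi⟩, rfl⟩
    refine ⟨n, c, ?_, h2⟩
    have := List.length_pos_iff.2 (hW'.column _ (List.getElem_mem i.2)).ne_nil
    have e : hW'.toKRPartition.height i + 1 = W'[i.1].2.length := by
      change W'[i.1].2.length - 1 + 1 = _
      omega
    rw [e]
    exact h1

variable [BorelSpace X]

open Classical in
/-- The sequence of Kakutani–Rokhlin partitions that defines the saturated element. All pairs of
clopen sets are enumerated and dealt with one after the other. -/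
theorem IsDynamicalSimplex.exists_sequence (hK : IsDynamicalSimplex K) [CompactSpace X]
    [TotallyDisconnectedSpace X] [PerfectSpace X] [Nonempty X] :
    ∃ S : ℕ → KRPartition K, (∀ n, (S (n + 1)).Refines (S n)) ∧
      Tendsto (fun n => Metric.diam (S n).base) atTop (𝓝 0) ∧
      Tendsto (fun n => Metric.diam (S n).top) atTop (𝓝 0) ∧
      (∀ U : Set X, IsClopen U → ∀ᶠ n in atTop, ∀ i, ∀ r ≤ (S n).height i,
        Decided U ((S n).atom i r)) ∧
      ∀ U V : Set X, IsClopen U → IsClopen V → KEquiv K U V → ∃ n,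
        (∀ i, ∀ r ≤ (S n).height i, Decided U ((S n).atom i r)) ∧
        (∀ i, ∀ r ≤ (S n).height i, Decided V ((S n).atom i r)) ∧
        ∀ i, ((Finset.range ((S n).height i + 1)).filter fun r => (S n).atom i r ⊆ U).card =
          ((Finset.range ((S n).height i + 1)).filter fun r => (S n).atom i r ⊆ V).card := by
  have : Countable (TopologicalSpace.Clopens X) :=
    TopologicalSpace.Clopens.countable_iff_secondCountable.2 inferInstance
  obtain ⟨e, he⟩ := exists_surjective_nat (TopologicalSpace.Clopens X × TopologicalSpace.Clopens X)
  have hstep : ∀ (n : ℕ) (W : {W // IsKRList K W}), ∃ W' : {W // IsKRList K W},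
      (∀ p ∈ W'.1, ∃ m, Stack W.1 m p.2) ∧
      (∃ D E : Set X, Metric.diam D ≤ 1 / ((n : ℝ) + 1) ∧ Metric.diam E ≤ 1 / ((n : ℝ) + 1) ∧
        ∀ p ∈ W'.1, baseAtom p.2 ⊆ D ∧ topAtom p.2 ⊆ E) ∧
      (∀ p ∈ W'.1, ∀ A ∈ p.2, Decided (e n).1 A ∧ Decided (e n).2 A) ∧
      (KEquiv K ((e n).1 : Set X) (e n).2 → ∀ p ∈ W'.1,
        countIn ((e n).1 : Set X) p.2 = countIn ((e n).2 : Set X) p.2) := by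
    rintro n ⟨W, hW⟩
    obtain ⟨W', h, h'⟩ := hK.exists_step hW (e n).1.isClopen (e n).2.isClopen
      (Nat.one_div_pos_of_nat (α := ℝ) (n := n))
    exact ⟨⟨W', h⟩, h'⟩
  choose F hF1 hF2 hF3 hF4 using hstep
  have h0 : IsKRList K [(0, [(univ : Set X)])] := by
    refine ⟨?_, fun x => by simp, by simp⟩
    simp only [List.mem_singleton, forall_eq]
    exact ⟨by simp, by simp [isClopen_univ], fun A hA B hB => by
      rw [List.mem_singleton.1 hA, List.mem_singleton.1 hB]
      exact fun _ _ => rfl⟩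
  let W : ℕ → {W // IsKRList K W} := fun n => Nat.rec ⟨_, h0⟩ F n
  have hWs : ∀ n, W (n + 1) = F n (W n) := fun n => rfl
  have dec : ∀ (U : Set X) (n : ℕ), (∀ p ∈ (W n).1, ∀ A ∈ p.2, Decided U A) → ∀ m ≥ n,
      ∀ p ∈ (W m).1, ∀ A ∈ p.2, Decided U A := by
    intro U n hn m hm
    induction m, hm using Nat.le_induction with
    | base => exact hn
    | succ m _ ih =>
      intro p hp A hA
      obtain ⟨w, hw⟩ := hF1 m (W m) p hp
      obtain ⟨q, hq, B, hB, hAB⟩ := hw.exists_superset A hA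
      exact (ih q hq B hB).mono hAB
  have lim : ∀ T : ℕ → Set X, (∀ n : ℕ, ∃ D, Metric.diam D ≤ 1 / ((n : ℝ) + 1) ∧ T (n + 1) ⊆ D) →
      Tendsto (fun n => Metric.diam (T n)) atTop (𝓝 0) := by
    intro T hT
    rw [← tendsto_add_atTop_iff_nat 1]
    refine squeeze_zero (fun _ => Metric.diam_nonneg) (fun n => ?_)
      tendsto_one_div_add_atTop_nhds_zero_nat
    obtain ⟨D, hD, hTD⟩ := hT n
    exact (Metric.diam_mono hTD (isCompact_univ.isBounded.subset (subset_univ D))).trans hD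
  refine ⟨fun n => (W n).2.toKRPartition, fun n => (W n).2.refines _ (hF1 n (W n)),
    lim _ fun n => ?_, lim _ fun n => ?_, fun U hU => ?_, fun U V hU hV hUV => ?_⟩
  · obtain ⟨D, E, hD, hE, h⟩ := hF2 n (W n)
    refine ⟨D, hD, fun x hx => ?_⟩
    obtain ⟨p, hp, hxp⟩ := ((W (n + 1)).2.base_toKRPartition x).1 hx
    exact (h p hp).1 hxp
  · obtain ⟨D, E, hD, hE, h⟩ := hF2 n (W n)
    refine ⟨E, hE, fun x hx => ?_⟩
    obtain ⟨p, hp, hxp⟩ := ((W (n + 1)).2.top_toKRPartition x).1 hx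
    exact (h p hp).2 hxp
  · obtain ⟨n, hn⟩ := he (⟨U, hU⟩, ⟨U, hU⟩)
    refine eventually_atTop.2 ⟨n + 1, fun m hm i r hr => ?_⟩
    refine dec U (n + 1) (fun p hp A hA => ?_) m hm _ (List.getElem_mem i.2) _
      ((W m).2.getD_mem i hr)
    have := (hF3 n (W n) p hp A hA).1
    rwa [hn] at this
  · obtain ⟨n, hn⟩ := he (⟨U, hU⟩, ⟨V, hV⟩)
    refine ⟨n + 1, fun i r hr => ?_, fun i r hr => ?_, fun i => ?_⟩
    · have := (hF3 n (W n) _ (List.getElem_mem i.2) _ ((W (n + 1)).2.getD_mem i hr)).1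
      rwa [hn] at this
    · have := (hF3 n (W n) _ (List.getElem_mem i.2) _ ((W (n + 1)).2.getD_mem i hr)).2
      rwa [hn] at this
    · have h1 := hF4 n (W n) (by rw [hn]; exact hUV) _ (List.getElem_mem i.2)
      rw [hn, countIn_eq_card, countIn_eq_card] at h1
      have h2 := List.length_pos_iff.2 ((W (n + 1)).2.column _ (List.getElem_mem i.2)).ne_nil
      have h3 : (W (n + 1)).2.toKRPartition.height i + 1 = (W (n + 1)).1[i.1].2.length := by
        change (W (n + 1)).1[i.1].2.length - 1 + 1 = _
        omega
      rw [h3]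
      exact h1

end ToKR

/-! ### Gluing homeomorphisms; consequences of saturation -/

section Glue

variable {X : Type*} [MetricSpace X] [CompactSpace X]

/-- Homeomorphisms restricted to the pieces of a finite clopen partition can be glued if the images
of the pieces form a partition as well. -/
theorem exists_glue {ι : Type*} {A : ι → Set X} (hA : ∀ i, IsClopen (A i))
    (hAd : Pairwise fun i j => Disjoint (A i) (A j)) (hAu : (⋃ i, A i) = univ) (k : ι → X ≃ₜ X)
    (hkd : Pairwise fun i j => Disjoint (k i '' A i) (k j '' A j))
    (hku : (⋃ i, k i '' A i) = univ) : ∃ h : X ≃ₜ X, ∀ i, ∀ x ∈ A i, h x = k i x := by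
  have hex : ∀ x, ∃ i, x ∈ A i := fun x => mem_iUnion.1 (hAu ▸ mem_univ x)
  choose idx hidx using hex
  have huniq : ∀ i, ∀ x ∈ A i, idx x = i := by
    intro i x hx
    by_contra hne
    exact Set.disjoint_left.1 (hAd hne) (hidx x) hx
  let f : X → X := fun x => k (idx x) x
  have hf : ∀ i, ∀ x ∈ A i, f x = k i x := fun i x hx => by
    change k (idx x) x = _
    rw [huniq i x hx]
  have hcont : Continuous f := by
    rw [continuous_iff_continuousAt]
    intro x
    refine (k (idx x)).continuous.continuousAt.congr ?_
    filter_upwards [(hA (idx x)).isOpen.mem_nhds (hidx x)] with y hy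
    exact (hf _ y hy).symm
  have hinj : Function.Injective f := by
    intro x y hxy
    by_cases h : idx x = idx y
    · have : k (idx x) x = k (idx y) y := hxy
      rw [h] at this
      exact (k (idx y)).injective this
    · refine (Set.disjoint_left.1 (hkd h) (mem_image_of_mem _ (hidx x)) ?_).elim
      have : k (idx x) x = k (idx y) y := hxy
      rw [this]
      exact mem_image_of_mem _ (hidx y)
  have hsurj : Function.Surjective f := by
    intro y
    obtain ⟨i, x, hx, rfl⟩ := mem_iUnion.1 (hku ▸ mem_univ y)
    exact ⟨x, hf i x hx⟩
  exact ⟨Continuous.homeoOfEquivCompactToT2 (f := Equiv.ofBijective f ⟨hinj, hsurj⟩) hcont, hf⟩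

omit [CompactSpace X] in
/-- A homeomorphism that agrees piecewise with elements of `[[g]]` is itself in `[[g]]`. -/
theorem mem_topologicalFullGroup_of_pieces {g h : X ≃ₜ X} {ι : Type} [Finite ι] {A : ι → Set X}
    (hA : ∀ i, IsClopen (A i)) (hAd : Pairwise fun i j => Disjoint (A i) (A j))
    (hAu : (⋃ i, A i) = univ)
    (hh : ∀ i, ∃ k ∈ topologicalFullGroup g, ∀ x ∈ A i, h x = k x) :
    h ∈ topologicalFullGroup g := by
  choose k hk hkx using hh
  have hk' : ∀ i, ∃ (κ : Type) (_ : Finite κ) (B : κ → Set X) (n : κ → ℤ),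
      (∀ j, IsClopen (B j)) ∧ (Pairwise fun j l => Disjoint (B j) (B l)) ∧ (⋃ j, B j) = univ ∧
        ∀ j, ∀ x ∈ B j, k i x = (g ^ n j) x := hk
  choose κ hκ B n hB hBd hBu hBn using hk'
  refine ⟨Σ i, κ i, inferInstance, fun p => A p.1 ∩ B p.1 p.2, fun p => n p.1 p.2,
    fun p => (hA p.1).inter (hB p.1 p.2), ?_, ?_, ?_⟩
  · rintro ⟨i, j⟩ ⟨i', j'⟩ hne
    by_cases hi : i = i'
    · subst hi
      have hj : j ≠ j' := fun hj => hne (by rw [hj])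
      exact (hBd i hj).mono inter_subset_right inter_subset_right
    · exact (hAd hi).mono inter_subset_left inter_subset_left
  · refine eq_univ_of_forall fun x => ?_
    obtain ⟨i, hi⟩ := mem_iUnion.1 (hAu ▸ mem_univ x)
    obtain ⟨j, hj⟩ := mem_iUnion.1 (hBu i ▸ mem_univ x)
    exact mem_iUnion.2 ⟨⟨i, j⟩, hi, hj⟩
  · rintro ⟨i, j⟩ x ⟨hi, hj⟩
    rw [hkx i x hi, hBn i j x hj]

omit [CompactSpace X] in
theorem zpow_mem_topologicalFullGroup (g : X ≃ₜ X) (n : ℤ) : g ^ n ∈ topologicalFullGroup g :=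
  ⟨Unit, inferInstance, fun _ => univ, fun _ => n, fun _ => isClopen_univ,
    fun _ _ h => (h rfl).elim, iUnion_const _, fun _ _ _ => rfl⟩

variable [MeasurableSpace X] [BorelSpace X] {K : Set (ProbabilityMeasure X)}

omit [CompactSpace X] in
theorem topologicalFullGroup_le_preservingGroup {g : X ≃ₜ X} (hg : g ∈ preservingGroup K) :
    topologicalFullGroup g ≤ preservingGroup K := by
  rintro h ⟨ι, hι, A, n, hA, hAd, hAu, hAn⟩ μ hμ
  refine Measure.ext fun E hE => ?_
  have himg : ∀ i, h '' A i = (g ^ n i) '' A i := fun i => image_congr (hAn i)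
  rw [Measure.map_apply h.continuous.measurable hE]
  have e1 : h ⁻¹' E = ⋃ i, (A i ∩ h ⁻¹' E) := by rw [← iUnion_inter, hAu, univ_inter]
  have e2 : E = ⋃ i, (h '' A i ∩ E) := by
    rw [← iUnion_inter, ← image_iUnion, hAu, image_univ, h.surjective.range_eq, univ_inter]
  have m1 : ∀ i, MeasurableSet (A i ∩ h ⁻¹' E) := fun i =>
    (hA i).isClosed.measurableSet.inter (h.continuous.measurable hE)
  have m2 : ∀ i, MeasurableSet (h '' A i ∩ E) := fun i =>
    (h.isClosedMap _ (hA i).isClosed).measurableSet.inter hE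
  have key : ∀ i, (μ : Measure X) (A i ∩ h ⁻¹' E) = (μ : Measure X) (h '' A i ∩ E) := by
    intro i
    have hgn : Measure.map (g ^ n i) (μ : Measure X) = μ :=
      (preservingGroup K).zpow_mem hg (n i) μ hμ
    rw [← hgn, Measure.map_apply (g ^ n i).continuous.measurable (m2 i), hgn]
    congr 1
    ext x
    constructor
    · rintro ⟨hx, hx'⟩
      refine ⟨himg i ▸ mem_image_of_mem _ hx, ?_⟩
      have : h x ∈ E := hx'
      rwa [hAn i x hx] at this
    · rintro ⟨hx, hx'⟩
      rw [himg i] at hx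
      obtain ⟨y, hy, hyx⟩ := hx
      obtain rfl := (g ^ n i).injective hyx
      refine ⟨hy, ?_⟩
      change h y ∈ E
      rwa [hAn i y hy]
  rw [e1, measure_iUnion (fun i j hij => (hAd hij).mono inter_subset_left inter_subset_left) m1]
  conv_rhs => rw [e2]
  rw [measure_iUnion (fun i j hij => ?_) m2]
  · exact tsum_congr key
  · exact ((disjoint_image_iff h.injective).2 (hAd hij)).mono inter_subset_left inter_subset_left

/-- A small clopen neighbourhood of `x` is equivalent to a subset of a given clopen set, so that
an element of `[[g]]`, hence a power of `g`, moves `x` into it. -/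
theorem IsSaturated.isMinimalHomeo [TotallyDisconnectedSpace X] (hK : IsDynamicalSimplex K)
    {g : X ≃ₜ X} (hg : IsSaturated K g) : IsMinimalHomeo g := by
  intro x
  rw [dense_iff_inter_open]
  rintro O hO ⟨y, hy⟩
  obtain ⟨U, hU, hyU, hUO⟩ := compact_exists_isClopen_in_isOpen hO hy
  obtain ⟨V, -, hV, hxV, hVU⟩ := hK.exists_small hU ⟨y, hyU⟩ isOpen_univ (mem_univ x)
  obtain ⟨C, hCU, hC, hCV⟩ := hK.exists_subset_of_lt hV hU hVU
  obtain ⟨h, ⟨ι, hι, A, n, -, -, hAu, hAn⟩, hVC⟩ := hg.2 V C hV hC hCV.symm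
  obtain ⟨i, hi⟩ := mem_iUnion.1 (hAu ▸ mem_univ x)
  have hx : h x ∈ C := hVC ▸ mem_image_of_mem h hxV
  exact ⟨h x, hUO (hCU hx), n i, (hAn i x hi).symm⟩

omit [CompactSpace X] in
theorem KEquiv.image {h : X ≃ₜ X} (hh : h ∈ preservingGroup K) {A : Set X} (hA : IsClopen A) :
    KEquiv K A (h '' A) := by
  intro μ hμ
  have h1 : Measure.map h (μ : Measure X) = μ := hh μ hμ
  have h2 : (μ : Measure X) (h '' A) = (μ : Measure X) A := by
    rw [← h1, Measure.map_apply h.continuous.measurable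
      (h.isClosedMap _ hA.isClosed).measurableSet, h1, h.injective.preimage_image]
  exact (congrArg ENNReal.toNNReal h2).symm

/-- On a partition into pieces whose images under `h` are small, saturation provides
elements of `[[g]]` that map the pieces as `h` does; they are glued together. -/
theorem IsSaturated.dense [TotallyDisconnectedSpace X] {g : X ≃ₜ X} (hg : IsSaturated K g) :
    Dense {h : preservingGroup K | (h : X ≃ₜ X) ∈ topologicalFullGroup g} := by
  intro h
  have hind : Topology.IsInducing fun h : preservingGroup K => ((h : X ≃ₜ X) : C(X, X)) :=
    Topology.IsInducing.comp (g := fun h : X ≃ₜ X => (h : C(X, X))) ⟨rfl⟩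
      Topology.IsInducing.subtypeVal
  rw [hind.closure_eq_preimage_closure_image]
  refine Metric.mem_closure_iff.2 fun ε hε => ?_
  have hS : {p : X × X | dist p.1 p.2 < ε} ∈ nhdsSet (diagonal X) := by
    refine (isOpen_lt continuous_dist continuous_const).mem_nhdsSet.2 ?_
    rintro ⟨x, y⟩ (rfl : x = y)
    simpa using hε
  obtain ⟨n, D, -, hD, hDu, hDd⟩ :=
    ContinuousMap.exists_disjoint_nonempty_clopen_cover_of_mem_nhds_diagonal
      ((h : X ≃ₜ X) : C(X, X)) hS
  have hDd' : Pairwise fun i j => Disjoint (D i : Set X) (D j) := fun i j hij => by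
    have := hDd hij
    rwa [Function.onFun, ← TopologicalSpace.Clopens.coe_disjoint] at this
  have hDu' : (⋃ i, (D i : Set X)) = univ := univ_subset_iff.1 hDu
  have hsat : ∀ i, ∃ k ∈ topologicalFullGroup g, k '' D i = (h : X ≃ₜ X) '' D i := fun i =>
    hg.2 _ _ (D i).isClopen ⟨(h : X ≃ₜ X).isClosedMap _ (D i).isClopen.isClosed,
      (h : X ≃ₜ X).isOpenMap _ (D i).isClopen.isOpen⟩ (KEquiv.image h.2 (D i).isClopen)
  choose k hk hkD using hsat
  obtain ⟨f, hf⟩ := exists_glue (fun i => (D i).isClopen) hDd' hDu' k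
    (fun i j hij => by
      simp only [hkD]
      exact (disjoint_image_iff (h : X ≃ₜ X).injective).2 (hDd' hij))
    (by
      simp only [hkD]
      rw [← image_iUnion, hDu', image_univ, (h : X ≃ₜ X).surjective.range_eq])
  have hfg : f ∈ topologicalFullGroup g :=
    mem_topologicalFullGroup_of_pieces (fun i => (D i).isClopen) hDd' hDu'
      fun i => ⟨k i, hk i, hf i⟩
  refine ⟨f, ⟨⟨f, topologicalFullGroup_le_preservingGroup hg.1 hfg⟩, hfg, rfl⟩, ?_⟩
  rw [ContinuousMap.dist_lt_iff hε]
  intro x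
  obtain ⟨i, hi⟩ := mem_iUnion.1 (hDu' ▸ mem_univ x)
  have h1 : f x ∈ (h : X ≃ₜ X) '' D i := by
    rw [hf i x hi, ← hkD]
    exact mem_image_of_mem _ hi
  obtain ⟨y, hy, hyx⟩ := h1
  have := hD i x hi y hy
  change dist ((h : X ≃ₜ X) x) (f x) < ε
  rw [← hyx]
  exact this

end Glue

/-! ### The limit of a sequence of Kakutani–Rokhlin partitions -/

namespace KRPartition

section Rel

variable {X : Type*} [TopologicalSpace X] [MeasurableSpace X] {K : Set (ProbabilityMeasure X)}
  (T : KRPartition K)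

/-- The pairs `(x, y)` such that `y` is a possible image of `x` under a map that extends `T`: the
point `y` lies in the atom above that of `x`, or `x` lies in the top and `y` in the base. -/
def rel : Set (X × X) :=
  {p | (∃ i, ∃ r < T.height i, p.1 ∈ T.atom i r ∧ p.2 ∈ T.atom i (r + 1)) ∨
    (p.1 ∈ T.top ∧ p.2 ∈ T.base)}

variable {T}

theorem index_eq {i j : T.Column} {r s : ℕ} (hr : r ≤ T.height i) (hs : s ≤ T.height j) {x : X}
    (hi : x ∈ T.atom i r) (hj : x ∈ T.atom j s) : i = j ∧ r = s := by
  by_contra h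
  refine Set.disjoint_left.1 (T.disjoint i r hr j s hs ?_) hi hj
  tauto

theorem isClosed_base : IsClosed T.base := by
  have := T.finite
  exact isClosed_iUnion_of_finite fun i => (T.isClopen i 0 (Nat.zero_le _)).isClosed

theorem isClosed_top : IsClosed T.top := by
  have := T.finite
  exact isClosed_iUnion_of_finite fun i => (T.isClopen i _ le_rfl).isClosed

theorem isClosed_rel : IsClosed T.rel := by
  have := T.finite
  have e : T.rel = (⋃ i, ⋃ r : Fin (T.height i), T.atom i r ×ˢ T.atom i (r + 1)) ∪
      T.top ×ˢ T.base := by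
    ext p
    simp only [rel, mem_ofPred_eq, mem_union, mem_iUnion, mem_prod]
    refine or_congr (exists_congr fun i => ?_) Iff.rfl
    exact ⟨fun ⟨r, hr, h⟩ => ⟨⟨r, hr⟩, h⟩, fun ⟨r, h⟩ => ⟨r, r.2, h⟩⟩
  rw [e]
  refine IsClosed.union ?_ (isClosed_top.prod isClosed_base)
  exact isClosed_iUnion_of_finite fun i => isClosed_iUnion_of_finite fun r =>
    (T.isClopen i r r.2.le).isClosed.prod (T.isClopen i (r + 1) r.2).isClosed

theorem mem_top_or (x : X) : x ∈ T.top ∨ ∃ i, ∃ r < T.height i, x ∈ T.atom i r := by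
  obtain ⟨i, r, hr, hx⟩ := T.cover x
  rcases hr.lt_or_eq with h | rfl
  · exact Or.inr ⟨i, r, h, hx⟩
  · exact Or.inl (mem_iUnion.2 ⟨i, hx⟩)

theorem mem_base_or (y : X) : y ∈ T.base ∨ ∃ i, ∃ r < T.height i, y ∈ T.atom i (r + 1) := by
  obtain ⟨i, r, hr, hy⟩ := T.cover y
  rcases r with _ | r
  · exact Or.inl (mem_iUnion.2 ⟨i, hy⟩)
  · exact Or.inr ⟨i, r, hr, hy⟩

theorem nonempty_base [Nonempty X] : T.base.Nonempty := by
  obtain ⟨x⟩ := ‹Nonempty X›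
  obtain ⟨i, -⟩ := T.cover x
  obtain ⟨y, hy⟩ := T.nonempty i 0 (Nat.zero_le _)
  exact ⟨y, mem_iUnion.2 ⟨i, hy⟩⟩

theorem nonempty_top [Nonempty X] : T.top.Nonempty := by
  obtain ⟨x⟩ := ‹Nonempty X›
  obtain ⟨i, -⟩ := T.cover x
  obtain ⟨y, hy⟩ := T.nonempty i _ le_rfl
  exact ⟨y, mem_iUnion.2 ⟨i, hy⟩⟩

theorem exists_rel_right (x : X) : ∃ y, (x, y) ∈ T.rel := by
  have : Nonempty X := ⟨x⟩
  rcases T.mem_top_or x with hx | ⟨i, r, hr, hx⟩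
  · obtain ⟨y, hy⟩ := T.nonempty_base
    exact ⟨y, Or.inr ⟨hx, hy⟩⟩
  · obtain ⟨y, hy⟩ := T.nonempty i (r + 1) hr
    exact ⟨y, Or.inl ⟨i, r, hr, hx, hy⟩⟩

theorem exists_rel_left (y : X) : ∃ x, (x, y) ∈ T.rel := by
  have : Nonempty X := ⟨y⟩
  rcases T.mem_base_or y with hy | ⟨i, r, hr, hy⟩
  · obtain ⟨x, hx⟩ := T.nonempty_top
    exact ⟨x, Or.inr ⟨hx, hy⟩⟩
  · obtain ⟨x, hx⟩ := T.nonempty i r hr.le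
    exact ⟨x, Or.inl ⟨i, r, hr, hx, hy⟩⟩

theorem notMem_top {i : T.Column} {r : ℕ} (hr : r < T.height i) {x : X} (hx : x ∈ T.atom i r) :
    x ∉ T.top := by
  intro h
  obtain ⟨j, hj⟩ := mem_iUnion.1 h
  obtain ⟨rfl, rfl⟩ := index_eq hr.le le_rfl hx hj
  exact hr.false

theorem notMem_base {i : T.Column} {r : ℕ} (hr : r < T.height i) {y : X}
    (hy : y ∈ T.atom i (r + 1)) : y ∉ T.base := by
  intro h
  obtain ⟨j, hj⟩ := mem_iUnion.1 h
  exact Nat.succ_ne_zero r (index_eq hr (Nat.zero_le _) hy hj).2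

theorem rel_atom_iff {x y : X} (h : (x, y) ∈ T.rel) {i : T.Column} {r : ℕ}
    (hr : r < T.height i) : x ∈ T.atom i r ↔ y ∈ T.atom i (r + 1) := by
  rcases h with ⟨j, s, hs, hx, hy⟩ | ⟨hx, hy⟩
  · constructor
    · intro h
      obtain ⟨rfl, rfl⟩ := index_eq hr.le hs.le h hx
      exact hy
    · intro h
      obtain ⟨rfl, h2⟩ := index_eq hr hs h hy
      obtain rfl : r = s := Nat.succ_injective h2
      exact hx
  · exact ⟨fun h => (notMem_top hr h hx).elim, fun h => (notMem_base hr h hy).elim⟩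

theorem rel_top_iff {x y : X} (h : (x, y) ∈ T.rel) : x ∈ T.top ↔ y ∈ T.base := by
  rcases h with ⟨j, s, hs, hx, hy⟩ | ⟨hx, hy⟩
  · exact ⟨fun h => (notMem_top hs hx h).elim, fun h => (notMem_base hs hy h).elim⟩
  · exact ⟨fun _ => hy, fun _ => hx⟩

theorem extendedBy_iff {g : X ≃ₜ X} : T.ExtendedBy g ↔ ∀ x, (x, g x) ∈ T.rel := by
  constructor
  · rintro ⟨h1, h2⟩ x
    rcases T.mem_top_or x with hx | ⟨i, r, hr, hx⟩
    · exact Or.inr ⟨hx, h2 ▸ mem_image_of_mem g hx⟩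
    · exact Or.inl ⟨i, r, hr, hx, h1 i r hr ▸ mem_image_of_mem g hx⟩
  · intro h
    refine ⟨fun i r hr => ?_, ?_⟩
    · ext y
      obtain ⟨x, rfl⟩ := g.surjective y
      rw [g.injective.mem_set_image]
      exact rel_atom_iff (h x) hr
    · ext y
      obtain ⟨x, rfl⟩ := g.surjective y
      rw [g.injective.mem_set_image]
      exact rel_top_iff (h x)

theorem exists_block (f : ℕ → ℕ) (m : ℕ) {r : ℕ} (hr : r < ∑ k ∈ Finset.range (m + 1), f k) :
    ∃ k ≤ m, ∃ j < f k, r = j + ∑ l ∈ Finset.range k, f l := by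
  induction m with
  | zero => exact ⟨0, le_rfl, r, by simpa using hr, by simp⟩
  | succ m ih =>
    by_cases h : r < ∑ k ∈ Finset.range (m + 1), f k
    · obtain ⟨k, hk, h⟩ := ih h
      exact ⟨k, by omega, h⟩
    · rw [Finset.sum_range_succ] at hr
      exact ⟨m + 1, le_rfl, r - ∑ k ∈ Finset.range (m + 1), f k, by omega, by omega⟩

theorem Refines.rel_subset {S : KRPartition K} (h : S.Refines T) : S.rel ⊆ T.rel := by
  obtain ⟨hb, ht, hcol⟩ := h
  rintro ⟨x, y⟩ (⟨i, r, hr, hx, hy⟩ | ⟨hx, hy⟩)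
  swap
  · exact Or.inr ⟨ht hx, hb hy⟩
  obtain ⟨m, c, hlen, hsub⟩ := hcol i
  obtain ⟨k, hk, j, hj, rfl⟩ := exists_block (fun k => T.height (c k) + 1) m (r := r) (by
    rw [← hlen]; omega)
  have hxT := hsub k hk j (by omega) hx
  dsimp only at hx hy hxT ⊢
  by_cases hjt : j < T.height (c k)
  · refine Or.inl ⟨c k, j, hjt, hxT, hsub k hk (j + 1) hjt ?_⟩
    rwa [add_right_comm]
  · -- The point `x` is at the end of a block, so that `y` is at the beginning of the next one.
    obtain rfl : j = T.height (c k) := by omega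
    have e : T.height (c k) + ∑ l ∈ Finset.range k, (T.height (c l) + 1) + 1 =
        0 + ∑ l ∈ Finset.range (k + 1), (T.height (c l) + 1) := by
      rw [Finset.sum_range_succ]
      omega
    have hkm : k + 1 ≤ m := by
      by_contra hcon
      obtain rfl : k = m := by omega
      omega
    rw [e] at hy
    exact Or.inr ⟨mem_iUnion.2 ⟨_, hxT⟩,
      mem_iUnion.2 ⟨c (k + 1), hsub (k + 1) hkm 0 (Nat.zero_le _) hy⟩⟩

theorem image_pow_atom {g : X ≃ₜ X} (h : T.ExtendedBy g) (i : T.Column) (r : ℕ)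
    (hr : r ≤ T.height i) : (g ^ r) '' T.atom i 0 = T.atom i r := by
  induction r with
  | zero => exact image_id _
  | succ r ih =>
    rw [← h.1 i r hr, ← ih (by omega), ← image_comp, pow_succ']
    rfl

theorem image_zpow_atom {g : X ≃ₜ X} (h : T.ExtendedBy g) (i : T.Column) {r s : ℕ}
    (hr : r ≤ T.height i) (hs : s ≤ T.height i) :
    (g ^ ((s : ℤ) - r)) '' T.atom i r = T.atom i s := by
  rw [← image_pow_atom h i r hr, ← image_pow_atom h i s hs, ← image_comp]
  have : g ^ ((s : ℤ) - r) * g ^ r = g ^ s := by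
    rw [← zpow_natCast, ← zpow_add, sub_add_cancel, zpow_natCast]
  rw [← this]
  rfl

end Rel

end KRPartition

section Limit

variable {X : Type*} [MetricSpace X] [CompactSpace X] [TotallyDisconnectedSpace X] [Nonempty X]
  [MeasurableSpace X] {K : Set (ProbabilityMeasure X)} {S : ℕ → KRPartition K}

omit [TotallyDisconnectedSpace X] [Nonempty X] [MeasurableSpace X] in
theorem eq_of_diam_tendsto {B : ℕ → Set X}
    (h : Tendsto (fun n => Metric.diam (B n)) atTop (𝓝 0)) {x y : X} (hx : ∀ n, x ∈ B n)
    (hy : ∀ n, y ∈ B n) : x = y := by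
  refine dist_le_zero.1 (ge_of_tendsto h (Eventually.of_forall fun n => ?_))
  exact Metric.dist_le_diam_of_mem (isCompact_univ.isBounded.subset (subset_univ _)) (hx n) (hy n)

omit [Nonempty X] in
/-- The intersection of the relations given by the partitions is a compact set, and the graph of the
limit homeomorphism. -/
theorem exists_limit (hS : ∀ n, (S (n + 1)).Refines (S n))
    (hb : Tendsto (fun n => Metric.diam (S n).base) atTop (𝓝 0))
    (ht : Tendsto (fun n => Metric.diam (S n).top) atTop (𝓝 0))
    (hdec : ∀ U : Set X, IsClopen U → ∀ᶠ n in atTop, ∀ i, ∀ r ≤ (S n).height i,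
      Decided U ((S n).atom i r)) :
    ∃ g : X ≃ₜ X, ∀ h : X ≃ₜ X, (∀ n, (S n).ExtendedBy h) ↔ h = g := by
  have anti : Antitone fun n => (S n).rel := antitone_nat_of_succ_le fun n => (hS n).rel_subset
  have antit : Antitone fun n => (S n).top := antitone_nat_of_succ_le fun n => (hS n).2.1
  have antib : Antitone fun n => (S n).base := antitone_nat_of_succ_le fun n => (hS n).1
  have exy : ∀ x, ∃ y, ∀ n, (x, y) ∈ (S n).rel := by
    intro x
    have hcl : ∀ n, IsClosed {y | (x, y) ∈ (S n).rel} := fun n =>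
      KRPartition.isClosed_rel.preimage (by fun_prop)
    obtain ⟨y, hy⟩ := IsCompact.nonempty_iInter_of_sequence_nonempty_isCompact_isClosed
      (fun n => {y | (x, y) ∈ (S n).rel}) (fun n y hy => (hS n).rel_subset hy)
      (fun n => KRPartition.exists_rel_right x) (hcl 0).isCompact hcl
    exact ⟨y, fun n => mem_iInter.1 hy n⟩
  have exx : ∀ y, ∃ x, ∀ n, (x, y) ∈ (S n).rel := by
    intro y
    have hcl : ∀ n, IsClosed {x | (x, y) ∈ (S n).rel} := fun n =>
      KRPartition.isClosed_rel.preimage (by fun_prop)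
    obtain ⟨x, hx⟩ := IsCompact.nonempty_iInter_of_sequence_nonempty_isCompact_isClosed
      (fun n => {x | (x, y) ∈ (S n).rel}) (fun n x hx => (hS n).rel_subset hx)
      (fun n => KRPartition.exists_rel_left y) (hcl 0).isCompact hcl
    exact ⟨x, fun n => mem_iInter.1 hx n⟩
  -- Distinct points are separated by a clopen set, hence lie in different atoms eventually.
  have sep : ∀ x y : X, (∀ n₀, ∃ n ≥ n₀, ∃ i, ∃ r ≤ (S n).height i, x ∈ (S n).atom i r ∧
      y ∈ (S n).atom i r) → x = y := by
    intro x y h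
    by_contra hne
    obtain ⟨U, hU, hxU, hUy⟩ := compact_exists_isClopen_in_isOpen
      (isOpen_compl_singleton (x := y)) hne
    obtain ⟨n₀, hn₀⟩ := eventually_atTop.1 (hdec U hU)
    obtain ⟨n, hn, i, r, hr, hx, hy⟩ := h n₀
    rcases hn₀ n hn i r hr with h | h
    · exact hUy (h hy) rfl
    · exact Set.disjoint_left.1 h hx hxU
  have uniqy : ∀ x y y', (∀ n, (x, y) ∈ (S n).rel) → (∀ n, (x, y') ∈ (S n).rel) → y = y' := by
    intro x y y' h h'
    by_cases hx : ∀ n, x ∈ (S n).top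
    · exact eq_of_diam_tendsto hb (fun n => (KRPartition.rel_top_iff (h n)).1 (hx n))
        fun n => (KRPartition.rel_top_iff (h' n)).1 (hx n)
    · push Not at hx
      obtain ⟨m, hm⟩ := hx
      refine sep y y' fun n₀ => ⟨max n₀ m, le_max_left _ _, ?_⟩
      obtain ⟨i, r, hr, hxr⟩ := ((S (max n₀ m)).mem_top_or x).resolve_left
        fun hx => hm (antit (le_max_right _ _) hx)
      exact ⟨i, r + 1, hr, (KRPartition.rel_atom_iff (h _) hr).1 hxr,
        (KRPartition.rel_atom_iff (h' _) hr).1 hxr⟩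
  have uniqx : ∀ x x' y, (∀ n, (x, y) ∈ (S n).rel) → (∀ n, (x', y) ∈ (S n).rel) → x = x' := by
    intro x x' y h h'
    by_cases hy : ∀ n, y ∈ (S n).base
    · exact eq_of_diam_tendsto ht (fun n => (KRPartition.rel_top_iff (h n)).2 (hy n))
        fun n => (KRPartition.rel_top_iff (h' n)).2 (hy n)
    · push Not at hy
      obtain ⟨m, hm⟩ := hy
      refine sep x x' fun n₀ => ⟨max n₀ m, le_max_left _ _, ?_⟩
      obtain ⟨i, r, hr, hyr⟩ := ((S (max n₀ m)).mem_base_or y).resolve_left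
        fun hy => hm (antib (le_max_right _ _) hy)
      exact ⟨i, r, hr.le, (KRPartition.rel_atom_iff (h _) hr).2 hyr,
        (KRPartition.rel_atom_iff (h' _) hr).2 hyr⟩
  choose f hf using exy
  have hcont : Continuous f := by
    rw [continuous_iff_isClosed]
    intro Z hZ
    have e : f ⁻¹' Z = Prod.fst '' ((⋂ n, (S n).rel) ∩ Prod.snd ⁻¹' Z) := by
      ext x
      constructor
      · exact fun hx => ⟨(x, f x), ⟨mem_iInter.2 (hf x), hx⟩, rfl⟩
      · rintro ⟨⟨x', y⟩, ⟨h1, h2⟩, rfl⟩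
        have := uniqy x' (f x') y (hf x') (mem_iInter.1 h1)
        change f x' ∈ Z
        rw [this]
        exact h2
    rw [e]
    exact (((isClosed_iInter fun n => KRPartition.isClosed_rel).inter
      (hZ.preimage continuous_snd)).isCompact.image continuous_fst).isClosed
  have hbij : Function.Bijective f := by
    constructor
    · intro x x' h
      exact uniqx x x' (f x) (hf x) (by rw [h]; exact hf x')
    · intro y
      obtain ⟨x, hx⟩ := exx y
      exact ⟨x, uniqy x _ _ (hf x) hx⟩
  refine ⟨Continuous.homeoOfEquivCompactToT2 (f := Equiv.ofBijective f hbij) hcont, fun h => ?_⟩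
  simp only [KRPartition.extendedBy_iff]
  constructor
  · intro hh
    ext x
    exact uniqy x _ _ (fun n => hh n x) (hf x)
  · rintro rfl n x
    exact hf x n

variable [BorelSpace X]

/-- The limit homeomorphism preserves the measures: a clopen set that avoids the point in the
intersection of the bases is a union of atoms outside the base of some partition, and the preimages
of these atoms are the atoms below them. -/
theorem mem_preservingGroup_of_extendedBy (hS : ∀ n, (S (n + 1)).Refines (S n))
    (hb : Tendsto (fun n => Metric.diam (S n).base) atTop (𝓝 0))
    (hdec : ∀ U : Set X, IsClopen U → ∀ᶠ n in atTop, ∀ i, ∀ r ≤ (S n).height i,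
      Decided U ((S n).atom i r)) {g : X ≃ₜ X} (hg : ∀ n, (S n).ExtendedBy g) :
    g ∈ preservingGroup K := by
  intro μ hμ
  obtain ⟨y₀, hy₀⟩ := IsCompact.nonempty_iInter_of_sequence_nonempty_isCompact_isClosed
    (fun n => (S n).base) (fun n => (hS n).1) (fun n => KRPartition.nonempty_base)
    KRPartition.isClosed_base.isCompact fun n => KRPartition.isClosed_base
  have key : ∀ E : Set X, IsClopen E → y₀ ∉ E → (μ : Measure X) (g ⁻¹' E) = (μ : Measure X) E := by
    intro E hE hy₀E
    obtain ⟨ε, hε, hball⟩ := Metric.isOpen_iff.1 hE.compl.isOpen y₀ hy₀E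
    obtain ⟨n, hn1, hn2⟩ := ((hdec E hE).and (hb.eventually_lt_const hε)).exists
    have hbase : ∀ y ∈ (S n).base, y ∉ E := fun y hy => hball (by
      refine lt_of_le_of_lt (Metric.dist_le_diam_of_mem ?_ hy (mem_iInter.1 hy₀ n)) hn2
      exact isCompact_univ.isBounded.subset (subset_univ _))
    have hrel := fun x => (KRPartition.extendedBy_iff.1 (hg n)) x
    have := (S n).finite
    let ι := Σ i : (S n).Column, Fin ((S n).height i)
    have : Countable ι := inferInstanceAs (Countable (Σ i : (S n).Column, Fin ((S n).height i)))
    let A : ι → Set X := fun p => E ∩ (S n).atom p.1 (p.2 + 1)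
    have hA : ∀ p, MeasurableSet (A p) := fun p =>
      (hE.inter ((S n).isClopen p.1 _ p.2.2)).isClosed.measurableSet
    have hAd : Pairwise (Function.onFun Disjoint A) := by
      rintro ⟨i, r⟩ ⟨j, s⟩ hne
      refine Set.disjoint_left.2 fun x hx hx' => hne ?_
      obtain ⟨rfl, h⟩ := KRPartition.index_eq r.2 s.2 hx.2 hx'.2
      rw [Fin.ext (Nat.succ_injective h)]
    have hAu : E = ⋃ p, A p := by
      ext x
      refine ⟨fun hx => ?_, fun hx => ?_⟩
      · obtain ⟨i, r, hr, hxr⟩ := ((S n).mem_base_or x).resolve_left fun h => hbase x h hx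
        exact mem_iUnion.2 ⟨⟨i, r, hr⟩, hx, hxr⟩
      · obtain ⟨p, hp⟩ := mem_iUnion.1 hx
        exact hp.1
    have hAm : ∀ p, (μ : Measure X) (g ⁻¹' A p) = (μ : Measure X) (A p) := by
      rintro ⟨i, r⟩
      have hpre : g ⁻¹' (S n).atom i (r + 1) = (S n).atom i r := by
        ext x
        exact (KRPartition.rel_atom_iff (hrel x) r.2).symm
      rcases hn1 i (r + 1) r.2 with h | h
      · have e : A ⟨i, r⟩ = (S n).atom i (r + 1) := inter_eq_right.2 h
        rw [e, hpre]
        have := (S n).equiv i r r.2.le (r + 1) r.2 μ hμ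
        exact (ENNReal.toNNReal_eq_toNNReal_iff' (measure_ne_top _ _) (measure_ne_top _ _)).1 this
      · have e : A ⟨i, r⟩ = ∅ := h.symm.inter_eq
        rw [e, preimage_empty]
    rw [hAu, preimage_iUnion, measure_iUnion hAd hA, measure_iUnion
      (fun p q hpq => (hAd hpq).preimage g) fun p => g.continuous.measurable (hA p)]
    exact tsum_congr hAm
  have key' : ∀ E : Set X, IsClopen E → (μ : Measure X) (g ⁻¹' E) = (μ : Measure X) E := by
    intro E hE
    by_cases hy : y₀ ∈ E
    · have h1 := key Eᶜ hE.compl (fun h => h hy)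
      have h2 := measure_compl (μ := (μ : Measure X)) hE.compl.isClosed.measurableSet
        (measure_ne_top _ _)
      have h3 := measure_compl (μ := (μ : Measure X))
        (hE.compl.preimage g.continuous).isClosed.measurableSet (measure_ne_top _ _)
      rw [← preimage_compl, compl_compl, h1] at h3
      rw [compl_compl] at h2
      rw [h3, h2]
    · exact key E hE hy
  have hgen : ‹MeasurableSpace X› = MeasurableSpace.generateFrom {s : Set X | IsClopen s} := by
    rw [BorelSpace.measurable_eq (α := X)]
    exact isTopologicalBasis_isClopen.borel_eq_generateFrom
  have hpi : IsPiSystem {s : Set X | IsClopen s} := fun s hs t ht _ => IsClopen.inter hs ht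
  have : IsFiniteMeasure (Measure.map g (μ : Measure X)) := by infer_instance
  refine ext_of_generate_finite _ hgen hpi (fun E hE => ?_) ?_
  · rw [Measure.map_apply g.continuous.measurable (IsClopen.isClosed hE).measurableSet]
    exact key' E hE
  · rw [Measure.map_apply g.continuous.measurable MeasurableSet.univ, preimage_univ]

omit [TotallyDisconnectedSpace X] [Nonempty X] [BorelSpace X] in
open Classical in
/-- If all atoms of a partition decide `U` and `V` and each column has as many atoms in `U` as
in `V`, then permuting the atoms of each column, by powers of a homeomorphism that extends the
partition, maps `U` onto `V`. -/
theorem exists_image_eq {T : KRPartition K} {g : X ≃ₜ X} (hg : T.ExtendedBy g) {U V : Set X}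
    (hU : ∀ i, ∀ r ≤ T.height i, Decided U (T.atom i r))
    (hV : ∀ i, ∀ r ≤ T.height i, Decided V (T.atom i r))
    (hcard : ∀ i, ((Finset.range (T.height i + 1)).filter fun r => T.atom i r ⊆ U).card =
      ((Finset.range (T.height i + 1)).filter fun r => T.atom i r ⊆ V).card) :
    ∃ h ∈ topologicalFullGroup g, h '' U = V := by
  have := T.finite
  have hσ : ∀ i, ∃ σ : Equiv.Perm (Fin (T.height i + 1)),
      ∀ r : Fin (T.height i + 1), T.atom i r ⊆ U ↔ T.atom i (σ r) ⊆ V := by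
    intro i
    have hc : Fintype.card {r : Fin (T.height i + 1) // T.atom i r ⊆ U} =
        Fintype.card {r : Fin (T.height i + 1) // T.atom i r ⊆ V} := by
      have := hcard i
      rw [Finset.card_filter, Finset.card_filter, Finset.sum_range, Finset.sum_range] at this
      rw [Fintype.card_subtype, Fintype.card_subtype, Finset.card_filter, Finset.card_filter]
      exact this
    let e := Fintype.equivOfCardEq hc
    refine ⟨e.extendSubtype, fun r => ⟨fun h => e.extendSubtype_mem r h, fun h => ?_⟩⟩
    by_contra hcon
    exact e.extendSubtype_not_mem r hcon h
  choose σ hσ using hσ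
  let A : (Σ i : T.Column, Fin (T.height i + 1)) → Set X := fun p => T.atom p.1 p.2
  have le : ∀ i, ∀ r : Fin (T.height i + 1), (r : ℕ) ≤ T.height i := fun i r => by omega
  have hA : ∀ p, IsClopen (A p) := fun p => T.isClopen p.1 _ (le _ _)
  have hAd : Pairwise fun p q => Disjoint (A p) (A q) := by
    rintro ⟨i, r⟩ ⟨j, s⟩ hne
    refine Set.disjoint_left.2 fun x hx hx' => hne ?_
    obtain ⟨rfl, h⟩ := KRPartition.index_eq (le _ r) (le _ s) hx hx'
    rw [Fin.ext h]
  have hAu : (⋃ p, A p) = univ := by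
    refine eq_univ_of_forall fun x => ?_
    obtain ⟨i, r, hr, hx⟩ := T.cover x
    exact mem_iUnion.2 ⟨⟨i, r, by omega⟩, hx⟩
  let k : (Σ i : T.Column, Fin (T.height i + 1)) → X ≃ₜ X :=
    fun p => g ^ (((σ p.1 p.2 : ℕ) : ℤ) - (p.2 : ℕ))
  have hk : ∀ p, k p '' A p = A ⟨p.1, σ p.1 p.2⟩ := fun p =>
    KRPartition.image_zpow_atom hg p.1 (le _ _) (le _ _)
  obtain ⟨h, hh⟩ := exists_glue hA hAd hAu k
    (by
      rintro ⟨i, r⟩ ⟨j, s⟩ hne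
      rw [hk, hk]
      refine hAd fun heq => hne ?_
      simp only [Sigma.mk.injEq] at heq
      obtain ⟨rfl, h⟩ := heq
      rw [(σ i).injective (eq_of_heq h)])
    (by
      refine eq_univ_of_forall fun y => ?_
      obtain ⟨⟨i, s⟩, hy⟩ := mem_iUnion.1 (hAu ▸ mem_univ y)
      refine mem_iUnion.2 ⟨⟨i, (σ i).symm s⟩, ?_⟩
      rw [hk]
      simpa using hy)
  refine ⟨h, mem_topologicalFullGroup_of_pieces hA hAd hAu
    fun p => ⟨k p, zpow_mem_topologicalFullGroup g _, hh p⟩, ?_⟩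
  have mem : ∀ W : Set X, (∀ i, ∀ r ≤ T.height i, Decided W (T.atom i r)) → ∀ p, ∀ x ∈ A p,
      (x ∈ W ↔ A p ⊆ W) := by
    intro W hW p x hx
    refine ⟨fun hxW => (hW p.1 p.2 (le _ _)).resolve_right fun hd => ?_, fun h => h hx⟩
    exact Set.disjoint_left.1 hd hx hxW
  ext y
  obtain ⟨x, rfl⟩ := h.surjective y
  rw [h.injective.mem_set_image]
  obtain ⟨p, hp⟩ := mem_iUnion.1 (hAu ▸ mem_univ x)
  have hhx : h x ∈ A ⟨p.1, σ p.1 p.2⟩ := by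
    rw [hh p x hp, ← hk]
    exact mem_image_of_mem _ hp
  rw [mem U hU p x hp, mem V hV _ _ hhx]
  exact hσ p.1 p.2

end Limit

end DynSimplex

theorem mainTheorem3 {X : Type*} [MetricSpace X] [CompactSpace X] [TotallyDisconnectedSpace X]
    [PerfectSpace X] [Nonempty X] [MeasurableSpace X] [BorelSpace X]
    (K : Set (ProbabilityMeasure X)) (hK : DynSimplex.IsDynamicalSimplex K) :
    (∃ g : X ≃ₜ X, DynSimplex.IsSaturated K g ∧
      ∃ S : ℕ → DynSimplex.KRPartition K, DynSimplex.IsLimitOfKRPartitions S g) ∧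
    (∀ g : X ≃ₜ X, DynSimplex.IsSaturated K g →
      DynSimplex.IsMinimalHomeo g ∧
      DynSimplex.topologicalFullGroup g ≤ DynSimplex.preservingGroup K ∧
      Dense {h : DynSimplex.preservingGroup K |
        (h : X ≃ₜ X) ∈ DynSimplex.topologicalFullGroup g}) := by
  refine ⟨?_, fun g hg => ⟨hg.isMinimalHomeo hK,
    DynSimplex.topologicalFullGroup_le_preservingGroup hg.1, hg.dense⟩⟩
  obtain ⟨S, hS, hb, ht, hdec, hbal⟩ := hK.exists_sequence
  obtain ⟨g, hg⟩ := DynSimplex.exists_limit hS hb ht hdec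
  have hext := (hg g).2 rfl
  refine ⟨g, ⟨DynSimplex.mem_preservingGroup_of_extendedBy hS hb hdec hext,
    fun U V hU hV hUV => ?_⟩, S, hS, hb, ht, hg⟩
  obtain ⟨n, h1, h2, h3⟩ := hbal U V hU hV hUV
  exact DynSimplex.exists_image_eq (hext n) h1 h2 h3
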